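/- Let $\mathcal T$ be the set of (finite or infinite) rooted planar trees in which every vertex has finitely many offspring and the root has exactly one; two trees are identified if there is an isomorphism between them preserving the root and the left-to-right order. For $T\in\mathcal T$ let $D_r(T)$ be the set of vertices at distance $r$ from the root, $|T|$ the number of edges, $h(T)=\sup\{r : D_r(T)\neq\emptyset\}$ the height, and $B_r(T)$ the subtree spanned by the vertices at distance at most $r$ from the root. Equip $\mathcal T$ with the metric $\mathrm{dist}(T,T')=\inf\{1/r : r\in\{1,2,\dots\},\ B_r(T)=B_r(T')\}$ and its Borel $\sigma$-algebra, and let $\mathcal B_a(T_0)=\{T\in\mathcal T : \mathrm{dist}(T,T_0)\le a\}$. Let $A_{m,N}$ be the number of trees of height at most $m$ and size $|T|=N$. For $\mu\in\mathbb R$ and $N\ge 1$ let $\nu_N^{(\mu)}$ be the probability measure on $\mathcal T$ supported on the trees of size $N$ with $$\nu_N^{(\mu)}(\{T\})=\frac{e^{-\mu h(T)}}{Z_N^{(\mu)}}\quad (|T|=N),\qquad Z_N^{(\mu)}=\sum_{m=1}^\infty e^{-\mu m}(A_{m,N}-A_{m-1,N}).$$ Let $X(g)=\sum_{T\ \mathrm{finite}}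 g^{|T|}$ and $g_c(k)=k/(1+k)^2$. **Theorem.** Let $\mu<0$ and $k=e^{-\mu}$. The series defining $X(g_c(k))$ converges, and the sequence $(\nu_N^{(\mu)})_{N\ge1}$ converges weakly to a Borel probability measure $\nu^{(\mu)}$ on $\mathcal T$. This measure satisfies $$\nu^{(\mu)}\big(\mathcal B_{1/r}(T_0)\big)=K\,k^{\,r-1}\,g_c(k)^{|T_0|-K}\,X(g_c(k))^{K-1},\qquad K=|D_r(T_0)|,$$ for every finite tree $T_0\in\mathcal T$ of height $r$, and it is the only Borel probability measure on $\mathcal T$ with this property. -/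

import Mathlib

open MeasureTheory Filter Topology

/-- Rooted planar trees, finite or infinite, every vertex having finitely many offspring, and the
root having exactly one, encoded by words of natural numbers. The root `i₀` is the empty word, the
offspring of a vertex `v` are, from left to right, `v ++ [0]`, `v ++ [1]`, …, `v ++ [n - 1]`, and
the parent of `v ++ [i]` is `v`. Every isomorphism class of rooted planar trees (with finite, totally
ordered generations, order-preserving parent maps and a single root edge) has exactly one such
code, so equality of codes is equality of planar trees. -/
@[ext]
structure PlaneTree where
  /-- the vertices of the tree -/
  verts : Set (List ℕ)
  root_mem : [] ∈ verts
  parent_mem : ∀ (v : List ℕ) (i : ℕ), v ++ [i] ∈ verts → v ∈ verts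
  offspring : ∀ v ∈ verts, ∃ n : ℕ, ∀ i : ℕ, v ++ [i] ∈ verts ↔ i < n
  root_edge : ∀ i : ℕ, [i] ∈ verts ↔ i = 0

namespace PlaneTree

/-- `D_r(T)`, the set of vertices of `T` at distance `r` from the root. -/
def level (T : PlaneTree) (r : ℕ) : Set (List ℕ) := {v ∈ T.verts | v.length = r}

/-- `E(T)`, the set of edges: each vertex other than the root is joined to its parent. -/
def edges (T : PlaneTree) : Set (Sym2 (List ℕ)) :=
  {e | ∃ (v : List ℕ) (i : ℕ), v ++ [i] ∈ T.verts ∧ e = s(v ++ [i], v)}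

/-- The size `|T|`, the number of edges; it is `⊤` exactly for infinite trees. -/
noncomputable def size (T : PlaneTree) : ℕ∞ := T.edges.encard

/-- The height `h(T)`, the supremum of all `r` with `D_r(T) ≠ ∅`. -/
noncomputable def height (T : PlaneTree) : ℕ∞ :=
  ⨆ (r : ℕ) (_ : (T.level r).Nonempty), (r : ℕ∞)

/-- `B_r(T)`, the ball of radius `r` around the root of `T`, given by its set of vertices
(with the above encoding the subtree is determined by this set). -/
def rootBall (T : PlaneTree) (r : ℕ) : Set (List ℕ) := {v ∈ T.verts | v.length ≤ r}

/-- The set of all `1 / r`, `r ≥ 1`, such that `B_r(T) = B_r(T')`. -/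
def agreeRadii (T T' : PlaneTree) : Set ℝ :=
  {a | ∃ r : ℕ, 1 ≤ r ∧ T.rootBall r = T'.rootBall r ∧ a = 1 / (r : ℝ)}

noncomputable instance : Dist PlaneTree := ⟨fun T T' => sInf (agreeRadii T T')⟩

theorem dist_def (T T' : PlaneTree) : dist T T' = sInf (agreeRadii T T') := rfl

theorem rootBall_one (T : PlaneTree) : T.rootBall 1 = {[], [0]} := by
  ext v
  rcases v with _ | ⟨i, _ | ⟨j, l⟩⟩
  · simp [rootBall, T.root_mem]
  · simp [rootBall, T.root_edge]
  · simp [rootBall]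

theorem rootBall_mono {T T' : PlaneTree} {r s : ℕ} (h : T.rootBall s = T'.rootBall s)
    (hrs : r ≤ s) : T.rootBall r = T'.rootBall r := by
  ext v
  have hv := Set.ext_iff.1 h v
  simp only [rootBall, Set.mem_ofPred_eq] at hv ⊢
  constructor
  · rintro ⟨h1, h2⟩
    exact ⟨(hv.1 ⟨h1, h2.trans hrs⟩).1, h2⟩
  · rintro ⟨h1, h2⟩
    exact ⟨(hv.2 ⟨h1, h2.trans hrs⟩).1, h2⟩

theorem agreeRadii_nonempty (T T' : PlaneTree) : (agreeRadii T T').Nonempty :=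
  ⟨1, 1, le_rfl, by rw [rootBall_one, rootBall_one], by simp⟩

theorem agreeRadii_nonneg {T T' : PlaneTree} {a : ℝ} (ha : a ∈ agreeRadii T T') : 0 ≤ a := by
  obtain ⟨r, _, _, rfl⟩ := ha
  positivity

theorem dist_le_of_mem {T T' : PlaneTree} {a : ℝ} (ha : a ∈ agreeRadii T T') : dist T T' ≤ a :=
  csInf_le ⟨0, fun _ h => agreeRadii_nonneg h⟩ ha

theorem dist_le_add {T T' T'' : PlaneTree} {a b : ℝ} (ha : a ∈ agreeRadii T T')
    (hb : b ∈ agreeRadii T' T'') : dist T T'' ≤ a + b := by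
  have ha0 := agreeRadii_nonneg ha
  have hb0 := agreeRadii_nonneg hb
  obtain ⟨r, hr, h1, rfl⟩ := ha
  obtain ⟨s, hs, h2, rfl⟩ := hb
  rcases le_total r s with h | h
  · refine (dist_le_of_mem ⟨r, hr, h1.trans (rootBall_mono h2 h), rfl⟩).trans ?_
    linarith
  · refine (dist_le_of_mem ⟨s, hs, (rootBall_mono h1 h).trans h2, rfl⟩).trans ?_
    linarith

/-- The metric `dist(T, T') = inf {1 / r | r ≥ 1, B_r(T) = B_r(T')}`. -/
noncomputable instance : MetricSpace PlaneTree where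
  dist_self T := by
    refine le_antisymm (le_of_forall_pos_le_add fun ε hε => ?_)
      (le_csInf (agreeRadii_nonempty T T) fun _ h => agreeRadii_nonneg h)
    obtain ⟨n, hn⟩ := exists_nat_one_div_lt hε
    have h : 1 / ((n + 1 : ℕ) : ℝ) ∈ agreeRadii T T := ⟨n + 1, by omega, rfl, rfl⟩
    have := dist_le_of_mem h
    push_cast at this
    linarith
  dist_comm T T' := by
    have : agreeRadii T T' = agreeRadii T' T := by
      ext a
      simp only [agreeRadii, Set.mem_ofPred_eq, eq_comm]
    rw [dist_def, dist_def, this]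
  dist_triangle T T' T'' := by
    have h1 : dist T T'' - dist T T' ≤ dist T' T'' := by
      refine le_csInf (agreeRadii_nonempty T' T'') fun b hb => ?_
      have h2 : dist T T'' - b ≤ dist T T' := by
        refine le_csInf (agreeRadii_nonempty T T') fun a ha => ?_
        have := dist_le_add ha hb
        linarith
      linarith
    linarith
  eq_of_dist_eq_zero {T T'} h := by
    ext v
    have hpos : (0 : ℝ) < 1 / ((v.length + 1 : ℕ) : ℝ) := by positivity
    rw [dist_def] at h
    obtain ⟨a, ⟨r, hr, hb, rfl⟩, hlt⟩ :=
      exists_lt_of_csInf_lt (agreeRadii_nonempty T T') (h.trans_lt hpos)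
    have hr0 : (0 : ℝ) < r := by exact_mod_cast hr
    have hlt' : v.length + 1 < r := by
      exact_mod_cast lt_of_one_div_lt_one_div hr0 hlt
    have hv := Set.ext_iff.1 hb v
    simp only [rootBall, Set.mem_ofPred_eq] at hv
    have hle : v.length ≤ r := by omega
    simpa [hle] using hv

noncomputable instance : MeasurableSpace PlaneTree := borel PlaneTree

instance : BorelSpace PlaneTree := ⟨rfl⟩

/-- `A_{m,N}`, the number of trees of height at most `m` and size `N`. -/
noncomputable def countTrees (m N : ℕ) : ℕ :=
  {T : PlaneTree | T.height ≤ m ∧ T.size = N}.ncard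

/-- `Z_N^{(μ)} = ∑_{m ≥ 1} e^{-μ m} (A_{m,N} - A_{m-1,N})`. -/
noncomputable def partitionFunction (μ : ℝ) (N : ℕ) : ℝ :=
  ∑' m : ℕ, Real.exp (-μ * (m + 1)) * ((countTrees (m + 1) N : ℝ) - countTrees m N)

/-- `ν_N^{(μ)}`, the measure on the space of all trees that gives mass
`e^{-μ h(T)} / Z_N^{(μ)}` to each tree `T` of size `N`. -/
noncomputable def finiteSizeMeasure (μ : ℝ) (N : ℕ) : Measure PlaneTree :=
  Measure.sum fun T : {T : PlaneTree // T.size = N} =>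
    ENNReal.ofReal (Real.exp (-μ * (T.1.height.toNat : ℝ)) / partitionFunction μ N) •
      Measure.dirac T.1

/-- `X(g) = ∑ g^{|T|}`, the sum over all finite trees `T`. -/
noncomputable def genFun (g : ℝ) : ℝ :=
  ∑' T : {T : PlaneTree // T.size ≠ ⊤}, g ^ T.1.size.toNat

/-- `g_c(k) = k / (1 + k)^2`. -/
noncomputable def criticalPoint (k : ℝ) : ℝ := k / (1 + k) ^ 2

end PlaneTree

namespace PlaneTree

/-! ### Elementary properties of plane trees -/

/-! Cutting a tree at level `r` leaves a core and `K` free trees grafted at the vertices of level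
`r`; sizes add up, and the height of the whole is `r - 1` plus the maximal height of the grafted
trees (`graftEquiv`, `card_cylinder_height_le`). Hence the mass of a ball under the measure on trees
of size `N` is `k^(r-1) g^(|T₀|-K)` times a quotient of coefficients of `W_K = ∑ k^m (X_m^K -
X_{m-1}^K)` and of `W_1`, where `X_m` counts trees of height at most `m` (`cylinderWeight_mul`,
`real_cylinder_of_le`). Everything rests on the coefficients of `W_K` at `g = g_c(k)`.

The recursion `X_{m+1} = g / (1 - X_m)` is a Möbius iteration. At `g_c(k)` its attracting fixed
point is `X = 1/(1+k)`, with multiplier exactly `1/k`, so the increments of `X_m` decay like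
`k^(-m)` and just balance the weight `k^m`. This makes `W_1` behave as if it had a simple pole at
`g_c(k)`. Complex analysis is avoided: the variable is rescaled so that the critical point is 1, and
the work is done in the ring of power series with absolutely summable coefficients, on which
evaluation at 1 is multiplicative. There `(1 - X) W_1` lies in the ring and has a positive value
(`exists_one_sub_X_mul_tiltedSeries_one`), so the coefficients of `W_1` converge to that value.
Moreover `W_K` differs from `K X^(K-1) W_1` by an element of the ring (`tiltedSeries_error`):
typically only one of the `K` trees is high. This gives both the limits of ball probabilities and
bounds uniform in `N`.

The bounds are summable over all balls of a fixed radius, which yields tightness, and Prokhorov's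
theorem yields cluster points. Balls are clopen, so every cluster point has the limiting ball
probabilities. Balls form a countable π-system generating the Borel sets, so there is only one
cluster point. -/

theorem mem_of_append (T : PlaneTree) (v w : List ℕ) (h : v ++ w ∈ T.verts) : v ∈ T.verts := by
  induction w using List.reverseRecOn with
  | nil => simpa using h
  | append_singleton w i ih =>
    rw [← List.append_assoc] at h
    exact ih (T.parent_mem _ _ h)

theorem append_singleton_mem_of_le (T : PlaneTree) {v : List ℕ} {i j : ℕ}
    (h : v ++ [i] ∈ T.verts) (hj : j ≤ i) : v ++ [j] ∈ T.verts := by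
  obtain ⟨n, hn⟩ := T.offspring v (T.parent_mem _ _ h)
  rw [hn] at h ⊢
  omega

theorem zero_mem (T : PlaneTree) : [0] ∈ T.verts := (T.root_edge 0).2 rfl

theorem cons_mem (T : PlaneTree) {i : ℕ} {w : List ℕ} (h : i :: w ∈ T.verts) : i = 0 :=
  (T.root_edge i).1 (T.mem_of_append [i] w h)

/-- An edge is named by its upper endpoint. In the injectivity argument word lengths exclude that
two edges agree with their endpoints swapped. -/
theorem size_eq_encard_verts (T : PlaneTree) : T.size = (T.verts \ {[]}).encard := by
  have h : T.edges = (fun v : List ℕ => s(v, v.dropLast)) '' (T.verts \ {[]}) := by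
    ext e
    constructor
    · rintro ⟨v, i, hv, rfl⟩
      exact ⟨v ++ [i], ⟨hv, by simp⟩, by simp⟩
    · rintro ⟨v, ⟨hv, hne⟩, rfl⟩
      obtain rfl | ⟨w, i, rfl⟩ := List.eq_nil_or_concat' v
      · simp at hne
      · exact ⟨w, i, hv, by simp⟩
  rw [size, h]
  refine Set.InjOn.encard_image ?_
  rintro v ⟨-, hv⟩ w ⟨-, hw⟩ hvw
  obtain rfl | ⟨v, i, rfl⟩ := List.eq_nil_or_concat' v
  · simp at hv
  obtain rfl | ⟨w, j, rfl⟩ := List.eq_nil_or_concat' w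
  · simp at hw
  simp only [List.dropLast_concat, Sym2.eq_iff] at hvw
  rcases hvw with h | ⟨h1, h2⟩
  · exact h.1
  · have h1 := congrArg List.length h1
    have h2 := congrArg List.length h2
    simp at h1 h2
    omega

theorem height_le_iff (T : PlaneTree) (m : ℕ) :
    T.height ≤ m ↔ ∀ v ∈ T.verts, v.length ≤ m := by
  simp only [height, iSup_le_iff, Nat.cast_le]
  constructor
  · intro h v hv
    exact h v.length ⟨v, hv, rfl⟩
  · rintro h r ⟨v, hv, rfl⟩
    exact h v hv

theorem height_eq_iff (T : PlaneTree) (r : ℕ) :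
    T.height = r ↔ (∀ v ∈ T.verts, v.length ≤ r) ∧ (T.level r).Nonempty := by
  constructor
  · intro h
    have h1 := (height_le_iff T r).1 h.le
    refine ⟨h1, ?_⟩
    rcases r with _ | r
    · exact ⟨[], T.root_mem, rfl⟩
    by_contra hne
    have : T.height ≤ r := by
      refine (height_le_iff T r).2 fun v hv => ?_
      have h2 := h1 v hv
      have h3 : v.length ≠ r + 1 := fun h3 => hne ⟨v, hv, h3⟩
      omega
    rw [h] at this
    norm_cast at this
    omega
  · rintro ⟨h1, h2⟩
    refine le_antisymm ((height_le_iff T r).2 h1) ?_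
    exact le_iSup₂_of_le r h2 le_rfl

theorem one_le_height (T : PlaneTree) : 1 ≤ T.height :=
  le_iSup₂_of_le 1 ⟨[0], T.zero_mem, rfl⟩ le_rfl

theorem one_le_size (T : PlaneTree) : 1 ≤ T.size := by
  rw [size_eq_encard_verts, Set.one_le_encard_iff_nonempty]
  exact ⟨[0], T.zero_mem, by simp⟩

/-- The nonempty prefixes of a vertex are distinct non-root vertices. -/
theorem height_le_size (T : PlaneTree) : T.height ≤ T.size := by
  rw [height]
  refine iSup₂_le fun r hr => ?_
  obtain ⟨v, hv, rfl⟩ := hr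
  rw [size_eq_encard_verts]
  have h : (fun j => v.take (j + 1)) '' (Finset.range v.length : Set ℕ) ⊆ T.verts \ {[]} := by
    rintro _ ⟨j, hj, rfl⟩
    refine ⟨T.mem_of_append _ (v.drop (j + 1)) (by simpa using hv), ?_⟩
    intro h
    have := congrArg List.length h
    simp at hj this
    subst this
    simp at hj
  refine le_trans (le_of_eq ?_) (Set.encard_le_encard h)
  rw [Set.InjOn.encard_image]
  · rw [Set.encard_coe_eq_coe_finsetCard, Finset.card_range]
  · intro i hi j hj hij
    have := congrArg List.length hij
    simp at hi hj this
    omega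

theorem size_ne_top_of_finite {T : PlaneTree} (h : T.verts.Finite) : T.size ≠ ⊤ := by
  rw [size_eq_encard_verts, Set.encard_ne_top_iff]
  exact h.subset Set.sdiff_subset

theorem le_of_mem_verts {T : PlaneTree} {N : ℕ} (h : T.size = N) {v : List ℕ} {i : ℕ}
    (hv : v ++ [i] ∈ T.verts) : i + 1 ≤ N := by
  have h1 : (fun j => v ++ [j]) '' (Finset.range (i + 1) : Set ℕ) ⊆ T.verts \ {[]} := by
    rintro _ ⟨j, hj, rfl⟩
    refine ⟨T.append_singleton_mem_of_le hv ?_, by simp⟩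
    simp at hj
    omega
  have h2 := Set.encard_le_encard h1
  rw [← size_eq_encard_verts, h, Set.InjOn.encard_image (fun a _ b _ hab => by simpa using hab),
    Set.encard_coe_eq_coe_finsetCard] at h2
  simp at h2
  exact_mod_cast h2

/-- Both the lengths and the letters of the vertices are bounded by `N`, so all these trees live in
one finite set of words. -/
theorem finite_setOf_size_eq (N : ℕ) : {T : PlaneTree | T.size = N}.Finite := by
  let L : Set (List ℕ) := {v | v.length ≤ N ∧ ∀ i ∈ v, i ∈ (Finset.range N : Set ℕ)}
  have hL : L.Finite := by
    have : L ⊆ ⋃ n ∈ Finset.range (N + 1),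
        (fun f : Fin n → ℕ => List.ofFn f) '' {f | ∀ i, f i ∈ (Finset.range N : Set ℕ)} := by
      rintro v ⟨hv, hi⟩
      simp only [Set.mem_iUnion]
      refine ⟨v.length, by simpa [Nat.lt_succ_iff] using hv, fun i => v.get i,
        fun i => hi _ (List.get_mem _ _), List.ofFn_get v⟩
    refine Set.Finite.subset ?_ this
    refine Set.Finite.biUnion (Finset.finite_toSet _) fun n _ => Set.Finite.image _ ?_
    have := Set.Finite.pi' (t := fun _ : Fin n => (Finset.range N : Set ℕ))
      fun _ => Finset.finite_toSet _
    exact this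
  refine Set.Finite.of_finite_image (f := PlaneTree.verts)
    (hL.finite_subsets.subset ?_) fun T _ T' _ h => PlaneTree.ext h
  rintro _ ⟨T, hT, rfl⟩ v hv
  refine ⟨(height_le_iff T N).1 (by rw [← (show T.size = N from hT)]; exact T.height_le_size) v hv,
    fun i hi => ?_⟩
  obtain ⟨a, b, rfl⟩ := List.append_of_mem hi
  have : a ++ [i] ∈ T.verts := T.mem_of_append _ b (by simpa using hv)
  have := le_of_mem_verts hT this
  simpa using this

/-- The finite set of all trees with `N` edges. -/
noncomputable def treesOfSize (N : ℕ) : Finset PlaneTree := (finite_setOf_size_eq N).toFinset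

@[simp]
theorem mem_treesOfSize {N : ℕ} {T : PlaneTree} : T ∈ treesOfSize N ↔ T.size = N := by
  simp [treesOfSize]

theorem finite_level (T : PlaneTree) (r : ℕ) : (T.level r).Finite := by
  induction r with
  | zero =>
    refine (Set.finite_singleton []).subset ?_
    rintro v ⟨-, hv⟩
    simpa using hv
  | succ r ih =>
    have h : ∀ v ∈ T.verts, {w | w ∈ T.verts ∧ w.dropLast = v ∧ w ≠ []}.Finite := by
      intro v hv
      obtain ⟨n, hn⟩ := T.offspring v hv
      refine ((Set.finite_Iio n).image fun i => v ++ [i]).subset ?_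
      rintro w ⟨hw, rfl, hne⟩
      obtain rfl | ⟨w, i, rfl⟩ := List.eq_nil_or_concat' w
      · simp at hne
      · simp only [List.dropLast_concat] at hn ⊢
        exact ⟨i, (hn i).1 hw, rfl⟩
    refine (Set.Finite.biUnion ih fun v hv => h v hv.1).subset ?_
    rintro w ⟨hw, hlen⟩
    obtain rfl | ⟨w, i, rfl⟩ := List.eq_nil_or_concat' w
    · simp at hlen
    · simp only [Set.mem_iUnion]
      refine ⟨w, ⟨T.parent_mem _ _ hw, by simpa using hlen⟩, hw, by simp, by simp⟩

theorem finite_rootBall (T : PlaneTree) (r : ℕ) : (T.rootBall r).Finite := by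
  refine (Set.Finite.biUnion (Set.finite_Iic r) fun n _ => T.finite_level n).subset ?_
  rintro v ⟨hv, hr⟩
  simp only [Set.mem_iUnion]
  exact ⟨v.length, hr, hv, rfl⟩

theorem mem_iff_of_rootBall_eq {T T' : PlaneTree} {r : ℕ} (h : T.rootBall r = T'.rootBall r)
    {v : List ℕ} (hv : v.length ≤ r) : v ∈ T.verts ↔ v ∈ T'.verts := by
  have := Set.ext_iff.1 h v
  simpa [rootBall, hv] using this

theorem rootBall_eq_iff {T T' : PlaneTree} {r : ℕ} : T.rootBall r = T'.rootBall r ↔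
    ∀ v : List ℕ, v.length ≤ r → (v ∈ T.verts ↔ v ∈ T'.verts) := by
  refine ⟨fun h v hv => mem_iff_of_rootBall_eq h hv, fun h => ?_⟩
  ext v
  simp only [rootBall, Set.mem_ofPred_eq]
  exact and_congr_left fun hv => h v hv

theorem level_eq_of_rootBall_eq {T T' : PlaneTree} {r : ℕ} (h : T.rootBall r = T'.rootBall r) :
    T.level r = T'.level r := by
  ext v
  simp only [level, Set.mem_ofPred_eq]
  exact and_congr_left fun hv => mem_iff_of_rootBall_eq h hv.le

/-- The truncation of a tree at height `s + 1`. -/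
def trunc (T : PlaneTree) (s : ℕ) : PlaneTree where
  verts := T.rootBall (s + 1)
  root_mem := ⟨T.root_mem, by simp⟩
  parent_mem v i h := ⟨T.parent_mem v i h.1, by have := h.2; simp at this; omega⟩
  offspring v hv := by
    obtain ⟨n, hn⟩ := T.offspring v hv.1
    by_cases h : v.length ≤ s
    · exact ⟨n, fun i => by simp [rootBall, hn, h]⟩
    · exact ⟨0, fun i => by simp [rootBall, h]⟩
  root_edge i := by simp [rootBall, T.root_edge]

theorem rootBall_trunc (T : PlaneTree) (s : ℕ) :
    (T.trunc s).rootBall (s + 1) = T.rootBall (s + 1) := by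
  ext v
  simp [trunc, rootBall]

theorem size_trunc_ne_top (T : PlaneTree) (s : ℕ) : (T.trunc s).size ≠ ⊤ :=
  size_ne_top_of_finite (T.finite_rootBall (s + 1))

theorem height_trunc_eq {T : PlaneTree} {s : ℕ} (h : (T.level (s + 1)).Nonempty) :
    (T.trunc s).height = (s + 1 : ℕ) := by
  refine (height_eq_iff _ _).2 ⟨fun v hv => hv.2, ?_⟩
  rwa [level_eq_of_rootBall_eq (T.rootBall_trunc s)]

theorem eq_of_rootBall_eq_of_level_empty {T T' : PlaneTree} {r : ℕ}
    (h : T.rootBall r = T'.rootBall r) (he : T.level r = ∅) : T = T' := by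
  have key : ∀ S : PlaneTree, S.level r = ∅ → ∀ v ∈ S.verts, v.length ≤ r := by
    intro S hS v hv
    by_contra hlt
    have : v.take r ∈ S.level r :=
      ⟨S.mem_of_append _ (v.drop r) (by simpa using hv), by simp; omega⟩
    simp [hS] at this
  have he' : T'.level r = ∅ := level_eq_of_rootBall_eq h ▸ he
  ext v
  exact ⟨fun hv => (mem_iff_of_rootBall_eq h (key T he v hv)).1 hv,
    fun hv => (mem_iff_of_rootBall_eq h (key T' he' v hv)).2 hv⟩

theorem mem_closedBall_iff (T T₀ : PlaneTree) {r : ℕ} (hr : 1 ≤ r) :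
    T ∈ Metric.closedBall T₀ (1 / (r : ℝ)) ↔ T.rootBall r = T₀.rootBall r := by
  rw [Metric.mem_closedBall]
  constructor
  · intro h
    have hr0 : (0 : ℝ) < r := by exact_mod_cast hr
    -- The infimum is not yet known to be attained. The threshold `1 / (r - 1/2)` lies strictly
    -- above `1 / r` but excludes every `1 / s` with `s < r`.
    have hlt : sInf (agreeRadii T T₀) < 1 / (r - 1 / 2 : ℝ) := by
      rw [← dist_def]
      refine h.trans_lt ?_
      have : (1 : ℝ) ≤ r := by exact_mod_cast hr
      apply one_div_lt_one_div_of_lt <;> linarith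
    obtain ⟨a, ⟨s, hs, hb, rfl⟩, ha⟩ := exists_lt_of_csInf_lt (agreeRadii_nonempty T T₀) hlt
    have hs0 : (0 : ℝ) < s := by exact_mod_cast hs
    have h1 : (r : ℝ) - 1 / 2 < s := lt_of_one_div_lt_one_div hs0 ha
    have h2 : r ≤ s := by
      by_contra hlt
      have : (s : ℝ) + 1 ≤ r := by exact_mod_cast (not_le.1 hlt)
      linarith
    exact rootBall_mono hb h2
  · intro h
    exact dist_le_of_mem ⟨r, hr, h, rfl⟩

/-- The set of all trees with the same ball of radius `r` as `T₀`. -/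
def cylinder (T₀ : PlaneTree) (r : ℕ) : Set PlaneTree := {T | T.rootBall r = T₀.rootBall r}

theorem closedBall_eq_cylinder (T₀ : PlaneTree) {r : ℕ} (hr : 1 ≤ r) :
    Metric.closedBall T₀ (1 / (r : ℝ)) = cylinder T₀ r := by
  ext T
  exact mem_closedBall_iff T T₀ hr

end PlaneTree

namespace PlaneTree

/-! ### Grafting trees at the vertices of a given level -/

/-- The part of `T` above a vertex `v`, together with the edge below `v`. -/
def branch (T : PlaneTree) (v : List ℕ) (hv : v ∈ T.verts) : PlaneTree where
  verts := {w | w = [] ∨ ∃ w', w = 0 :: w' ∧ v ++ w' ∈ T.verts}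
  root_mem := Or.inl rfl
  parent_mem w i h := by
    rcases h with h | ⟨w', h, hw⟩
    · simp at h
    · rcases w with _ | ⟨j, w⟩
      · exact Or.inl rfl
      · simp only [List.cons_append, List.cons.injEq] at h
        obtain ⟨rfl, rfl⟩ := h
        rw [← List.append_assoc] at hw
        exact Or.inr ⟨w, rfl, T.parent_mem _ _ hw⟩
  offspring w hw := by
    rcases hw with rfl | ⟨w', rfl, hw⟩
    · refine ⟨1, fun i => ?_⟩
      constructor
      · rintro (h | ⟨w', h, -⟩)
        · simp at h
        · simp at h
          omega
      · intro h
        obtain rfl : i = 0 := by omega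
        exact Or.inr ⟨[], rfl, by simpa using hv⟩
    · obtain ⟨n, hn⟩ := T.offspring _ hw
      refine ⟨n, fun i => ?_⟩
      rw [← hn]
      simp
  root_edge i := by
    constructor
    · rintro (h | ⟨w', h, -⟩)
      · simp at h
      · simp at h
        exact h.1
    · rintro rfl
      exact Or.inr ⟨[], rfl, by simpa using hv⟩

theorem cons_mem_branch (T : PlaneTree) (v : List ℕ) (hv : v ∈ T.verts) (w : List ℕ) :
    0 :: w ∈ (T.branch v hv).verts ↔ v ++ w ∈ T.verts := by
  simp [branch]

/-- Two trees agree if they agree on all words starting with `0`. -/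
theorem ext_cons {T T' : PlaneTree} (h : ∀ w, 0 :: w ∈ T.verts ↔ 0 :: w ∈ T'.verts) : T = T' := by
  ext v
  rcases v with _ | ⟨i, w⟩
  · simp [T.root_mem, T'.root_mem]
  · by_cases hi : i = 0
    · subst hi
      exact h w
    · exact ⟨fun h => absurd (T.cons_mem h) hi, fun h => absurd (T'.cons_mem h) hi⟩

theorem append_eq_append_of_mem_level {T : PlaneTree} {r : ℕ} {v v' : T.level r} {w w' : List ℕ}
    (h : v.1 ++ w = v'.1 ++ w') : v = v' ∧ w = w' := by
  have := List.append_inj h (v.2.2.trans v'.2.2.symm)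
  exact ⟨Subtype.ext this.1, this.2⟩

/-- The tree obtained from `T₀` by replacing the edge below each vertex `v` at level `s + 1`, and
everything above `v`, by the tree `f v`. -/
def graft (T₀ : PlaneTree) (s : ℕ) (f : T₀.level (s + 1) → PlaneTree) : PlaneTree where
  verts := {w | (w ∈ T₀.verts ∧ w.length ≤ s) ∨
    ∃ (v : T₀.level (s + 1)) (w' : List ℕ), w = v.1 ++ w' ∧ 0 :: w' ∈ (f v).verts}
  root_mem := Or.inl ⟨T₀.root_mem, by simp⟩
  parent_mem v i h := by
    rcases h with ⟨h, hl⟩ | ⟨u, w', h, hw⟩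
    · exact Or.inl ⟨T₀.parent_mem _ _ h, by simp at hl; omega⟩
    · obtain rfl | ⟨w, j, rfl⟩ := List.eq_nil_or_concat' w'
      · simp only [List.append_nil] at h
        refine Or.inl ⟨T₀.parent_mem v i (h ▸ u.2.1), ?_⟩
        have := congrArg List.length h
        rw [u.2.2] at this
        simp at this
        omega
      · rw [← List.append_assoc] at h
        obtain ⟨rfl, -⟩ := List.append_inj' h rfl
        exact Or.inr ⟨u, w, rfl, (f u).parent_mem (0 :: w) j hw⟩
  offspring v hv := by
    rcases hv with ⟨h, hl⟩ | ⟨u, w', rfl, hw⟩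
    · obtain ⟨n, hn⟩ := T₀.offspring v h
      refine ⟨n, fun i => ?_⟩
      rw [← hn]
      constructor
      · rintro (h | ⟨u, w', h, hw⟩)
        · exact h.1
        · have hlen := congrArg List.length h
          simp only [List.length_append, u.2.2, List.length_singleton] at hlen
          obtain rfl : w' = [] := List.length_eq_zero_iff.1 (by omega)
          rw [h, List.append_nil]
          exact u.2.1
      · intro hi
        by_cases hs : v.length + 1 ≤ s
        · exact Or.inl ⟨hi, by simpa using hs⟩
        · exact Or.inr ⟨⟨v ++ [i], hi, by simp; omega⟩, [], by simp, (f _).zero_mem⟩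
    · obtain ⟨n, hn⟩ := (f u).offspring _ hw
      refine ⟨n, fun i => ?_⟩
      rw [← hn]
      constructor
      · rintro (⟨h, hl⟩ | ⟨u', w, h, hw⟩)
        · simp [u.2.2] at hl
          omega
        · rw [List.append_assoc] at h
          obtain ⟨rfl, rfl⟩ := append_eq_append_of_mem_level h
          simpa using hw
      · intro h
        exact Or.inr ⟨u, w' ++ [i], by simp, h⟩
  root_edge i := by
    constructor
    · rintro (h | ⟨u, w', h, hw⟩)
      · exact (T₀.root_edge i).1 h.1
      · have hu : u.1 ≠ [] := fun hu => by have := u.2.2; simp [hu] at this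
        obtain ⟨j, l, hj⟩ := List.exists_cons_of_ne_nil hu
        have h0 := T₀.cons_mem (hj ▸ u.2.1)
        rw [hj] at h
        simp at h
        omega
    · rintro rfl
      rcases s with _ | s
      · exact Or.inr ⟨⟨[0], T₀.zero_mem, rfl⟩, [], by simp, (f _).zero_mem⟩
      · exact Or.inl ⟨T₀.zero_mem, by simp⟩

theorem append_mem_graft (T₀ : PlaneTree) (s : ℕ) (f : T₀.level (s + 1) → PlaneTree)
    (v : T₀.level (s + 1)) (w : List ℕ) :
    v.1 ++ w ∈ (graft T₀ s f).verts ↔ 0 :: w ∈ (f v).verts := by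
  constructor
  · rintro (⟨-, h⟩ | ⟨u, w', h, hw⟩)
    · simp [v.2.2] at h
      omega
    · obtain ⟨rfl, rfl⟩ := append_eq_append_of_mem_level h
      exact hw
  · intro h
    exact Or.inr ⟨v, w, rfl, h⟩

theorem rootBall_graft (T₀ : PlaneTree) (s : ℕ) (f : T₀.level (s + 1) → PlaneTree) :
    (graft T₀ s f).rootBall (s + 1) = T₀.rootBall (s + 1) := by
  rw [rootBall_eq_iff]
  intro v hv
  constructor
  · rintro (h | ⟨u, w', h, hw⟩)
    · exact h.1
    · have hlen := congrArg List.length h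
      simp only [List.length_append, u.2.2] at hlen
      obtain rfl : w' = [] := List.length_eq_zero_iff.1 (by omega)
      rw [h, List.append_nil]
      exact u.2.1
  · intro h
    by_cases hs : v.length ≤ s
    · exact Or.inl ⟨h, hs⟩
    · exact Or.inr ⟨⟨v, h, by omega⟩, [], by simp, (f _).zero_mem⟩

theorem level_subset_of_mem_cylinder {T T₀ : PlaneTree} {r : ℕ} (h : T ∈ cylinder T₀ r)
    (v : T₀.level r) : v.1 ∈ T.verts :=
  (mem_iff_of_rootBall_eq h v.2.2.le).2 v.2.1

/-- The trees with a given ball of radius `s + 1` are parametrized by families of trees, indexed by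
the vertices at level `s + 1`. -/
def graftEquiv (T₀ : PlaneTree) (s : ℕ) :
    (T₀.level (s + 1) → PlaneTree) ≃ cylinder T₀ (s + 1) where
  toFun f := ⟨graft T₀ s f, rootBall_graft T₀ s f⟩
  invFun T v := T.1.branch v.1 (level_subset_of_mem_cylinder T.2 v)
  left_inv f := by
    funext v
    refine ext_cons fun w => ?_
    rw [cons_mem_branch, append_mem_graft]
  right_inv := by
    rintro ⟨T, hT⟩
    refine Subtype.ext (PlaneTree.ext (Set.ext fun w => ?_))
    by_cases hw : w.length ≤ s + 1
    · rw [mem_iff_of_rootBall_eq (rootBall_graft T₀ s _) hw, mem_iff_of_rootBall_eq hT hw]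
    · have key : ∀ S : PlaneTree, S ∈ cylinder T₀ (s + 1) → w ∈ S.verts →
          w.take (s + 1) ∈ T₀.level (s + 1) := by
        intro S hS hwS
        rw [← level_eq_of_rootBall_eq hS]
        exact ⟨S.mem_of_append _ (w.drop (s + 1)) (by simpa using hwS), by simp; omega⟩
      have main : ∀ hv : w.take (s + 1) ∈ T₀.level (s + 1),
          (w ∈ (graft T₀ s fun v =>
            T.branch v.1 (level_subset_of_mem_cylinder hT v)).verts ↔ w ∈ T.verts) := by
        intro hv
        have := append_mem_graft T₀ s (fun v =>
            T.branch v.1 (level_subset_of_mem_cylinder hT v)) ⟨_, hv⟩ (w.drop (s + 1))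
        rw [cons_mem_branch] at this
        simpa using this
      exact ⟨fun h => (main (key _ (rootBall_graft T₀ s _) h)).1 h,
        fun h => (main (key _ hT h)).2 h⟩

/-- The number of edges of `T` below the vertices at level `s + 1`, not counting the edges that end
in these vertices. -/
noncomputable def coreSize (T : PlaneTree) (s : ℕ) : ℕ :=
  {v ∈ T.verts | v ≠ [] ∧ v.length ≤ s}.ncard

theorem finite_core (T : PlaneTree) (s : ℕ) : {v ∈ T.verts | v ≠ [] ∧ v.length ≤ s}.Finite :=
  (T.finite_rootBall s).subset fun _ hv => ⟨hv.1, hv.2.2⟩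

theorem verts_sdiff_graft (T₀ : PlaneTree) (s : ℕ) (f : T₀.level (s + 1) → PlaneTree) :
    (graft T₀ s f).verts \ {[]} = {v ∈ T₀.verts | v ≠ [] ∧ v.length ≤ s} ∪
      ⋃ v : T₀.level (s + 1), (fun w : List ℕ => v.1 ++ w.tail) '' ((f v).verts \ {[]}) := by
  ext w
  simp only [Set.mem_union, Set.mem_iUnion]
  constructor
  · rintro ⟨h | ⟨v, w', rfl, h⟩, hne⟩
    · exact Or.inl ⟨h.1, hne, h.2⟩
    · exact Or.inr ⟨v, 0 :: w', ⟨h, by simp⟩, rfl⟩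
  · rintro (⟨h1, h2, h3⟩ | ⟨v, w', ⟨h, hne⟩, rfl⟩)
    · exact ⟨Or.inl ⟨h1, h3⟩, h2⟩
    · rcases w' with _ | ⟨i, w'⟩
      · simp at hne
      · obtain rfl := (f v).cons_mem h
        refine ⟨Or.inr ⟨v, w', rfl, h⟩, ?_⟩
        intro h0
        have := congrArg List.length h0
        simp [v.2.2] at this

theorem size_graft (T₀ : PlaneTree) (s : ℕ) [Fintype (T₀.level (s + 1))]
    (f : T₀.level (s + 1) → PlaneTree) :
    (graft T₀ s f).size = T₀.coreSize s + ∑ v, (f v).size := by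
  rw [size_eq_encard_verts, verts_sdiff_graft, Set.encard_union_eq, Set.encard_iUnion_of_finite,
    finsum_eq_sum_of_fintype, coreSize, Set.Finite.cast_ncard_eq (T₀.finite_core s)]
  · congr 1
    refine Finset.sum_congr rfl fun v _ => ?_
    rw [size_eq_encard_verts]
    refine Set.InjOn.encard_image ?_
    rintro a ⟨ha, ha0⟩ b ⟨hb, hb0⟩ hab
    rcases a with _ | ⟨i, a⟩
    · simp at ha0
    rcases b with _ | ⟨j, b⟩
    · simp at hb0
    obtain rfl := (f v).cons_mem ha
    obtain rfl := (f v).cons_mem hb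
    simpa using hab
  · intro v v' hvv'
    refine Set.disjoint_left.2 ?_
    rintro _ ⟨a, -, rfl⟩ ⟨b, -, hb⟩
    exact hvv' (append_eq_append_of_mem_level hb).1.symm
  · refine Set.disjoint_left.2 ?_
    rintro a ⟨-, -, ha⟩ hb
    simp only [Set.mem_iUnion] at hb
    obtain ⟨v, w, -, rfl⟩ := hb
    simp [v.2.2] at ha
    omega

/-- The root of `f v` sits at the parent of `v`, on level `s`, because branches include the edge
below `v`. -/
theorem height_graft_le_iff (T₀ : PlaneTree) (s : ℕ) (f : T₀.level (s + 1) → PlaneTree) (m : ℕ) :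
    (graft T₀ s f).height ≤ (s + m : ℕ) ↔ ∀ v, (f v).height ≤ m := by
  simp only [height_le_iff]
  constructor
  · intro h v w hw
    rcases w with _ | ⟨i, w⟩
    · simp
    · obtain rfl := (f v).cons_mem hw
      have := h _ ((append_mem_graft T₀ s f v w).2 hw)
      simp [v.2.2] at this ⊢
      omega
  · rintro h w (⟨-, hw⟩ | ⟨v, w', rfl, hw⟩)
    · omega
    · have := h v _ hw
      simp [v.2.2] at this ⊢
      omega

/-- In a tree of height `s + 1` every edge outside the core ends at the top level. This identifies
the exponent `coreSize` with `|T₀| - K`. -/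
theorem size_eq_coreSize_add {T : PlaneTree} {s n K : ℕ} (hn : T.size = n)
    (hT : T.height = (s + 1 : ℕ)) (hK : (T.level (s + 1)).encard = K) : n = T.coreSize s + K := by
  have h : T.verts \ {[]} = {v ∈ T.verts | v ≠ [] ∧ v.length ≤ s} ∪ T.level (s + 1) := by
    ext v
    have hlen := (height_le_iff T _).1 hT.le v
    simp only [level, Set.mem_sdiff, Set.mem_singleton_iff, Set.mem_union, Set.mem_ofPred_eq]
    constructor
    · rintro ⟨h1, h2⟩
      have := hlen h1
      by_cases h3 : v.length ≤ s
      · exact Or.inl ⟨h1, h2, h3⟩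
      · exact Or.inr ⟨h1, by omega⟩
    · rintro (⟨h1, h2, h3⟩ | ⟨h1, h2⟩)
      · exact ⟨h1, h2⟩
      · exact ⟨h1, by rintro rfl; simp at h2⟩
  have := T.size_eq_encard_verts
  rw [h, Set.encard_union_eq, hK, ← Set.Finite.cast_ncard_eq (T.finite_core s), hn] at this
  · exact_mod_cast this
  · refine Set.disjoint_left.2 ?_
    rintro a ⟨-, -, ha⟩ ⟨-, hb⟩
    omega

end PlaneTree

namespace PlaneTree

open PowerSeries

/-! ### Generating functions of trees of bounded height -/

/-- The generating function `X_m` of trees of height at most `m`. -/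
noncomputable def heightSeries (m : ℕ) : ℝ⟦X⟧ := PowerSeries.mk fun N => (countTrees m N : ℝ)

/-- The generating function of all finite trees. -/
noncomputable def treeSeries : ℝ⟦X⟧ := PowerSeries.mk fun N => (countTrees N N : ℝ)

open Classical in
theorem countTrees_eq_card (m N : ℕ) :
    countTrees m N = ((treesOfSize N).filter fun T : PlaneTree => T.height ≤ (m : ℕ∞)).card := by
  rw [countTrees, ← Set.ncard_coe_finset]
  congr 1
  ext T
  simp [and_comm]

theorem countTrees_mono {m m' : ℕ} (h : m ≤ m') (N : ℕ) : countTrees m N ≤ countTrees m' N := by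
  classical
  rw [countTrees_eq_card, countTrees_eq_card]
  refine Finset.card_le_card (Finset.monotone_filter_right _ fun T _ hT => ?_)
  exact le_trans hT (by exact_mod_cast h)

theorem countTrees_stable {m N : ℕ} (h : N ≤ m) : countTrees m N = countTrees N N := by
  classical
  rw [countTrees_eq_card, countTrees_eq_card]
  congr 1
  refine Finset.filter_congr fun T hT => ?_
  have h1 := T.height_le_size
  rw [mem_treesOfSize.1 hT] at h1
  exact ⟨fun _ => h1, fun _ => h1.trans (by exact_mod_cast h)⟩

theorem countTrees_self (N : ℕ) : countTrees N N = (treesOfSize N).card := by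
  classical
  rw [countTrees_eq_card, Finset.filter_true_of_mem]
  intro T hT
  have h1 := T.height_le_size
  rwa [mem_treesOfSize.1 hT] at h1

theorem countTrees_zero_left (N : ℕ) : countTrees 0 N = 0 := by
  classical
  rw [countTrees_eq_card, Finset.card_eq_zero, Finset.filter_eq_empty_iff]
  intro T _ h
  have := T.one_le_height.trans h
  simp at this

theorem countTrees_zero_right (m : ℕ) : countTrees m 0 = 0 := by
  classical
  rw [countTrees_eq_card, Finset.card_eq_zero, Finset.filter_eq_empty_iff]
  intro T hT _
  have := T.one_le_size
  rw [mem_treesOfSize.1 hT] at this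
  simp at this

theorem coeff_heightSeries (m N : ℕ) : coeff N (heightSeries m) = (countTrees m N : ℝ) :=
  coeff_mk _ _

theorem coeff_treeSeries (N : ℕ) : coeff N treeSeries = (countTrees N N : ℝ) :=
  coeff_mk _ _

theorem heightSeries_zero : heightSeries 0 = 0 := by
  ext N
  simp [coeff_heightSeries, countTrees_zero_left]

/-- Congruence modulo `X ^ (M + 1)` is preserved by powers. -/
theorem coeff_pow_congr {F G : ℝ⟦X⟧} {M : ℕ} (h : ∀ n ≤ M, coeff n F = coeff n G) (K : ℕ) :
    coeff M (F ^ K) = coeff M (G ^ K) := by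
  have h1 : (X : ℝ⟦X⟧) ^ (M + 1) ∣ F - G := by
    rw [X_pow_dvd_iff]
    intro n hn
    rw [map_sub, h n (by omega), sub_self]
  have h2 := (X_pow_dvd_iff.1 (h1.trans (sub_dvd_pow_sub_pow F G K))) M (by omega)
  rwa [map_sub, sub_eq_zero] at h2

-- A power of a generating function counts tuples. Up to degree `M` the series may be replaced by
-- the polynomial `∑ X ^ |T|` over the finitely many admissible trees of size at most `M`, whose
-- power expands as a finite product of sums.
open Classical in
theorem coeff_pow_heightSeries {ι : Type*} [Fintype ι] [DecidableEq ι] (m M : ℕ) :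
    coeff M (heightSeries m ^ Fintype.card ι) =
      ((Finset.filter (fun f : ι → PlaneTree => ∑ v, (f v).size.toNat = M)
        (Fintype.piFinset fun _ : ι =>
          ((Finset.range (M + 1)).biUnion treesOfSize).filter
            fun T : PlaneTree => T.height ≤ (m : ℕ∞))).card : ℝ) := by
  set S := ((Finset.range (M + 1)).biUnion treesOfSize).filter
    fun T : PlaneTree => T.height ≤ (m : ℕ∞) with hS
  set P : ℝ⟦X⟧ := ∑ T ∈ S, X ^ T.size.toNat with hP
  have hPc : ∀ n ≤ M, coeff n (heightSeries m) = coeff n P := by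
    intro n hn
    rw [coeff_heightSeries, countTrees_eq_card, hP, map_sum]
    simp_rw [coeff_X_pow]
    rw [Finset.sum_boole]
    congr 2
    ext T
    simp only [hS, Finset.mem_filter, Finset.mem_biUnion, Finset.mem_range, mem_treesOfSize]
    constructor
    · rintro ⟨h1, h2⟩
      exact ⟨⟨⟨n, by omega, h1⟩, h2⟩, by simp [h1]⟩
    · rintro ⟨⟨⟨n', -, h1⟩, h2⟩, h3⟩
      rw [h1] at h3
      simp at h3
      subst h3
      exact ⟨h1, h2⟩
  rw [coeff_pow_congr hPc, ← Finset.card_univ, ← Finset.prod_const, hP, Finset.prod_univ_sum]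
  simp_rw [Finset.prod_pow_eq_pow_sum]
  rw [map_sum]
  simp_rw [coeff_X_pow]
  rw [Finset.sum_boole]
  simp_rw [eq_comm]

open Classical in
/-- Trees with a given ball of radius `s + 1` are counted by a monomial times a power of the
generating function of trees of bounded height. -/
theorem card_cylinder_height_le (T₀ : PlaneTree) (s m N : ℕ) {K : ℕ}
    (hK : (T₀.level (s + 1)).encard = K) :
    (((treesOfSize N).filter fun T => T ∈ cylinder T₀ (s + 1) ∧ T.height ≤ (s + m : ℕ)).card : ℝ) =
      coeff N (X ^ T₀.coreSize s * heightSeries m ^ K) := by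
  have : Fintype (T₀.level (s + 1)) := (T₀.finite_level (s + 1)).fintype
  have hK' : K = Fintype.card (T₀.level (s + 1)) := by
    rw [Set.encard_eq_coe_toFinset_card, Set.toFinset_card] at hK
    exact_mod_cast hK.symm
  have hsize : ∀ T ∈ cylinder T₀ (s + 1), ∀ h : T ∈ cylinder T₀ (s + 1),
      T.size = T₀.coreSize s + ∑ v, ((graftEquiv T₀ s).symm ⟨T, h⟩ v).size := by
    intro T _ h
    rw [← size_graft]
    exact congrArg size (congrArg Subtype.val ((graftEquiv T₀ s).apply_symm_apply ⟨T, h⟩)).symm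
  rw [coeff_X_pow_mul']
  split_ifs with hN
  · obtain ⟨M, rfl⟩ := Nat.exists_eq_add_of_le hN
    rw [Nat.add_sub_cancel_left, hK', coeff_pow_heightSeries]
    congr 1
    symm
    refine Finset.card_bij (fun f _ => graft T₀ s f) ?_ ?_ ?_
    · intro f hf
      simp only [Finset.mem_filter, Fintype.mem_piFinset, Finset.mem_biUnion, Finset.mem_range,
        mem_treesOfSize] at hf ⊢
      obtain ⟨h1, h2⟩ := hf
      refine ⟨?_, rootBall_graft T₀ s f, (height_graft_le_iff T₀ s f m).2 fun v => (h1 v).2⟩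
      rw [size_graft]
      push_cast
      rw [← h2]
      push_cast
      congr 1
      refine Finset.sum_congr rfl fun v _ => ?_
      obtain ⟨n, -, hn⟩ := (h1 v).1
      simp [hn]
    · intro f _ f' _ h
      exact (graftEquiv T₀ s).injective (Subtype.ext h)
    · intro T hT
      simp only [Finset.mem_filter, mem_treesOfSize] at hT
      obtain ⟨h1, h2, h3⟩ := hT
      have hs := hsize T h2 h2
      have hgraft : graft T₀ s ((graftEquiv T₀ s).symm ⟨T, h2⟩) = T :=
        congrArg Subtype.val ((graftEquiv T₀ s).apply_symm_apply ⟨T, h2⟩)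
      refine ⟨(graftEquiv T₀ s).symm ⟨T, h2⟩, ?_, hgraft⟩
      rw [h1] at hs
      push_cast at hs
      have hs' : ∑ v, ((graftEquiv T₀ s).symm ⟨T, h2⟩ v).size = (M : ℕ∞) :=
        ENat.add_right_injective_of_ne_top (ENat.natCast_ne_top (T₀.coreSize s)) hs.symm
      have hle : ∀ v, ((graftEquiv T₀ s).symm ⟨T, h2⟩ v).size ≤ (M : ℕ∞) := fun v =>
        (Finset.single_le_sum (f := fun v => ((graftEquiv T₀ s).symm ⟨T, h2⟩ v).size)
          (fun _ _ => zero_le) (Finset.mem_univ v)).trans hs'.le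
      have hcoe : ∀ v, (((graftEquiv T₀ s).symm ⟨T, h2⟩ v).size.toNat : ℕ∞) =
          ((graftEquiv T₀ s).symm ⟨T, h2⟩ v).size := fun v =>
        ENat.natCast_toNat (ne_top_of_le_ne_top (ENat.natCast_ne_top M) (hle v))
      simp only [Finset.mem_filter, Fintype.mem_piFinset, Finset.mem_biUnion, Finset.mem_range,
        mem_treesOfSize]
      refine ⟨fun v => ⟨⟨_, ?_, (hcoe v).symm⟩, ?_⟩, ?_⟩
      · have := hle v
        rw [← hcoe v] at this
        have : ((graftEquiv T₀ s).symm ⟨T, h2⟩ v).size.toNat ≤ M := by exact_mod_cast this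
        omega
      · rw [← hgraft] at h3
        exact (height_graft_le_iff T₀ s _ m).1 h3 v
      · have : ((∑ v, ((graftEquiv T₀ s).symm ⟨T, h2⟩ v).size.toNat : ℕ) : ℕ∞) = M := by
          push_cast
          simp_rw [hcoe]
          exact hs'
        exact_mod_cast this
  · rw [Nat.cast_eq_zero, Finset.card_eq_zero, Finset.filter_eq_empty_iff]
    rintro T hT ⟨h2, -⟩
    have hs := hsize T h2 h2
    rw [mem_treesOfSize.1 hT] at hs
    have : (T₀.coreSize s : ℕ∞) ≤ N := hs ▸ le_self_add
    exact hN (by exact_mod_cast this)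

/-- The tree of height at most two in which the vertex next to the root has `K` offspring. -/
def star (K : ℕ) : PlaneTree where
  verts := {v | v = [] ∨ v = [0] ∨ ∃ i < K, v = [0, i]}
  root_mem := Or.inl rfl
  parent_mem v i h := by
    rcases h with h | h | ⟨j, hj, h⟩
    · simp at h
    · exact Or.inl (List.append_inj' (s₂ := []) h rfl).1
    · exact Or.inr (Or.inl (List.append_inj' (s₂ := [0]) h rfl).1)
  offspring v hv := by
    rcases hv with rfl | rfl | ⟨j, hj, rfl⟩
    · exact ⟨1, fun i => by simp⟩
    · exact ⟨K, fun i => by simp⟩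
    · exact ⟨0, fun i => by simp⟩
  root_edge i := by simp

theorem coreSize_star (K : ℕ) : (star K).coreSize 1 = 1 := by
  rw [coreSize, Set.ncard_eq_one]
  refine ⟨[0], ?_⟩
  ext v
  simp only [star, Set.mem_ofPred_eq, Set.mem_singleton_iff]
  constructor
  · rintro ⟨h | h | ⟨i, hi, h⟩, hne, hlen⟩
    · exact absurd h hne
    · exact h
    · simp [h] at hlen
  · rintro rfl
    simp

theorem encard_level_star (K : ℕ) : ((star K).level 2).encard = K := by
  have : (star K).level 2 = (fun i => [0, i]) '' (Finset.range K : Set ℕ) := by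
    ext v
    simp only [level, star, Set.mem_ofPred_eq, Set.mem_image]
    constructor
    · rintro ⟨h | h | ⟨i, hi, h⟩, hlen⟩
      · simp [h] at hlen
      · simp [h] at hlen
      · exact ⟨i, by simpa using hi, h.symm⟩
    · rintro ⟨i, hi, rfl⟩
      exact ⟨Or.inr (Or.inr ⟨i, by simpa using hi, rfl⟩), by simp⟩
  rw [this, Set.InjOn.encard_image (fun a _ b _ hab => by simpa using hab),
    Set.encard_coe_eq_coe_finsetCard, Finset.card_range]

theorem mem_cylinder_star_iff (T : PlaneTree) (K : ℕ) :
    T ∈ cylinder (star K) 2 ↔ ∀ i, [0, i] ∈ T.verts ↔ i < K := by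
  rw [cylinder, Set.mem_ofPred_eq, rootBall_eq_iff]
  constructor
  · intro h i
    rw [h [0, i] (by simp)]
    simp [star]
  · intro h v hv
    rcases v with _ | ⟨i, _ | ⟨j, _ | ⟨l, v⟩⟩⟩
    · simp [T.root_mem, (star K).root_mem]
    · rw [T.root_edge, (star K).root_edge]
    · by_cases hi : i = 0
      · subst hi
        rw [h]
        simp [star]
      · exact ⟨fun h => absurd (T.cons_mem h) hi, fun h => absurd ((star K).cons_mem h) hi⟩
    · simp at hv

/-- Every tree has the same ball of radius two as some star. -/
theorem exists_mem_cylinder_star (T : PlaneTree) : ∃ K, T ∈ cylinder (star K) 2 := by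
  obtain ⟨n, hn⟩ := T.offspring [0] T.zero_mem
  exact ⟨n, (mem_cylinder_star_iff T n).2 hn⟩

theorem cylinder_star_unique {T : PlaneTree} {K K' : ℕ} (h : T ∈ cylinder (star K) 2)
    (h' : T ∈ cylinder (star K') 2) : K = K' := by
  rw [mem_cylinder_star_iff] at h h'
  have h1 : ∀ i, i < K ↔ i < K' := fun i => (h i).symm.trans (h' i)
  have := h1 K
  have := h1 K'
  omega

/-- Trees are sorted by the number `K` of offspring of the vertex next to the root, that is, by the
star forming their ball of radius two. The core is the single root edge, and `K ≤ N` since those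
offspring already use `K` edges. -/
theorem coeff_succ_heightSeries_succ (m N : ℕ) :
    coeff (N + 1) (heightSeries (m + 1)) =
      ∑ K ∈ Finset.range (N + 1), coeff N (heightSeries m ^ K) := by
  classical
  have h : ∀ K, coeff N (heightSeries m ^ K) = (((treesOfSize (N + 1)).filter fun T =>
      T ∈ cylinder (star K) 2 ∧ T.height ≤ (1 + m : ℕ)).card : ℝ) := by
    intro K
    rw [card_cylinder_height_le (star K) 1 m (N + 1) (encard_level_star K), coreSize_star, pow_one,
      coeff_succ_X_mul]
  simp_rw [h]
  rw [coeff_heightSeries, countTrees_eq_card, ← Nat.cast_sum, Nat.cast_inj]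
  choose K hK using exists_mem_cylinder_star
  rw [Finset.card_eq_sum_card_fiberwise (f := K) (t := Finset.range (N + 1))]
  · refine Finset.sum_congr rfl fun j _ => ?_
    rw [Finset.filter_filter]
    congr 1
    refine Finset.filter_congr fun T _ => ?_
    rw [and_comm, add_comm m 1]
    refine and_congr_left fun _ => ⟨fun h => h ▸ hK T, fun h => cylinder_star_unique (hK T) h⟩
  · intro T hT
    have hT : T.size = (N + 1 : ℕ) := by
      simp only [Finset.coe_filter, Set.mem_ofPred_eq, mem_treesOfSize] at hT
      exact hT.1
    simp only [Finset.coe_range, Set.mem_Iio]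
    rw [size_eq_encard_verts] at hT
    have hsub : insert [0] ((fun i => [0, i]) '' (Finset.range (K T) : Set ℕ)) ⊆
        T.verts \ {[]} := by
      rintro v (rfl | ⟨i, hi, rfl⟩)
      · exact ⟨T.zero_mem, by simp⟩
      · exact ⟨((mem_cylinder_star_iff T _).1 (hK T) i).2 (by simpa using hi), by simp⟩
    have := Set.encard_le_encard hsub
    rw [Set.encard_insert_of_notMem (by simp),
      Set.InjOn.encard_image (fun a _ b _ hab => by simpa using hab),
      Set.encard_coe_eq_coe_finsetCard, Finset.card_range, hT] at this
    have : K T + 1 ≤ N + 1 := by exact_mod_cast this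
    omega

theorem coeff_pow_eq_zero {F : ℝ⟦X⟧} (h : coeff 0 F = 0) {n K : ℕ} (hn : n < K) :
    coeff n (F ^ K) = 0 := by
  have h1 : (X : ℝ⟦X⟧) ∣ F := by
    rw [X_dvd_iff]
    simpa using h
  exact X_pow_dvd_iff.1 (pow_dvd_pow_of_dvd h1 K) n hn

/-- The recursion `X_{m+1} = g / (1 - X_m)`. -/
theorem one_sub_mul_heightSeries_succ (m : ℕ) :
    (1 - heightSeries m) * heightSeries (m + 1) = X := by
  set Y : ℝ⟦X⟧ := PowerSeries.mk fun N => coeff (N + 1) (heightSeries (m + 1)) with hY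
  have h1 : heightSeries (m + 1) = X * Y := by
    ext N
    rcases N with _ | N
    · rw [coeff_heightSeries, countTrees_zero_right]
      simp
    · rw [coeff_succ_X_mul, hY, coeff_mk]
  have h0 : coeff 0 (heightSeries m) = 0 := by
    rw [coeff_heightSeries, countTrees_zero_right, Nat.cast_zero]
  have h2 : (1 - heightSeries m) * Y = 1 := by
    ext N
    -- Since `X` divides `X_m`, powers beyond the `N`th do not matter modulo `X ^ (N + 1)`, and `Y`
    -- is a truncated geometric series there.
    have hdvd : (X : ℝ⟦X⟧) ^ (N + 1) ∣ Y - ∑ K ∈ Finset.range (N + 1), heightSeries m ^ K := by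
      rw [X_pow_dvd_iff]
      intro n hn
      rw [map_sub, map_sum, hY, coeff_mk, coeff_succ_heightSeries_succ, sub_eq_zero]
      refine Finset.sum_subset (Finset.range_subset_range.2 (by omega)) fun K _ hK => ?_
      exact coeff_pow_eq_zero h0 (by simpa using hK)
    have h3 := X_pow_dvd_iff.1 (hdvd.mul_left (1 - heightSeries m)) N (by omega)
    rw [mul_sub, map_sub, sub_eq_zero, mul_neg_geom_sum, map_sub,
      coeff_pow_eq_zero h0 (Nat.lt_succ_self N), sub_zero] at h3
    exact h3
  rw [h1, mul_left_comm, h2, mul_one]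

theorem coeff_heightSeries_stable {m n : ℕ} (h : n ≤ m) :
    coeff n (heightSeries m) = coeff n treeSeries := by
  rw [coeff_heightSeries, coeff_treeSeries, countTrees_stable h]

/-- This is the limit of the recursion as `m` grows: each coefficient is stationary once `m` reaches
its degree. -/
theorem one_sub_mul_treeSeries : (1 - treeSeries) * treeSeries = X := by
  ext n
  rw [← one_sub_mul_heightSeries_succ n, coeff_mul, coeff_mul]
  refine Finset.sum_congr rfl fun p hp => ?_
  have hp := Finset.HasAntidiagonal.mem_antidiagonal.1 hp
  rw [map_sub, map_sub, coeff_heightSeries_stable (m := n) (by omega),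
    coeff_heightSeries_stable (m := n + 1) (by omega)]

end PlaneTree

namespace PowerSeries

/-! ### Power series with absolutely summable coefficients -/

/-- All coefficients are nonnegative. -/
def CoeffNonneg (F : ℝ⟦X⟧) : Prop := ∀ n, 0 ≤ coeff n F

/-- The coefficients are absolutely summable. -/
def AbsSummable (F : ℝ⟦X⟧) : Prop := Summable fun n => ‖coeff n F‖

/-- The value at one. -/
noncomputable def evalOne (F : ℝ⟦X⟧) : ℝ := ∑' n, coeff n F

namespace CoeffNonneg

variable {F G F' G' : ℝ⟦X⟧}

theorem add (hF : CoeffNonneg F) (hG : CoeffNonneg G) : CoeffNonneg (F + G) := fun n => by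
  rw [map_add]
  exact add_nonneg (hF n) (hG n)

theorem mul (hF : CoeffNonneg F) (hG : CoeffNonneg G) : CoeffNonneg (F * G) := fun n => by
  rw [coeff_mul]
  exact Finset.sum_nonneg fun p _ => mul_nonneg (hF _) (hG _)

theorem const {a : ℝ} (ha : 0 ≤ a) : CoeffNonneg (C a) := fun n => by
  rw [coeff_C]
  split_ifs <;> simp [ha]

theorem one : CoeffNonneg 1 := by
  simpa using const (a := 1) zero_le_one

theorem pow (hF : CoeffNonneg F) (n : ℕ) : CoeffNonneg (F ^ n) := by
  induction n with
  | zero => simpa using one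
  | succ n ih =>
    rw [pow_succ]
    exact ih.mul hF

theorem sum {ι : Type*} {s : Finset ι} {f : ι → ℝ⟦X⟧} (h : ∀ i ∈ s, CoeffNonneg (f i)) :
    CoeffNonneg (∑ i ∈ s, f i) := fun n => by
  rw [map_sum]
  exact Finset.sum_nonneg fun i hi => h i hi n

theorem mul_sub_mul (hF : CoeffNonneg F) (hG' : CoeffNonneg G') (hFG : CoeffNonneg (G - F))
    (hFG' : CoeffNonneg (G' - F')) : CoeffNonneg (G * G' - F * F') := by
  have : G * G' - F * F' = (G - F) * G' + F * (G' - F') := by ring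
  rw [this]
  exact (hFG.mul hG').add (hF.mul hFG')

theorem pow_sub_pow (hF : CoeffNonneg F) (hG : CoeffNonneg G) (hFG : CoeffNonneg (G - F)) (n : ℕ) :
    CoeffNonneg (G ^ n - F ^ n) := by
  induction n with
  | zero => intro n; simp
  | succ n ih =>
    rw [pow_succ, pow_succ]
    exact mul_sub_mul (hF.pow n) hG ih hFG

end CoeffNonneg

namespace AbsSummable

variable {F G : ℝ⟦X⟧}

theorem summable (hF : AbsSummable F) : Summable fun n => coeff n F := Summable.of_norm hF

theorem add (hF : AbsSummable F) (hG : AbsSummable G) : AbsSummable (F + G) := by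
  refine Summable.of_nonneg_of_le (fun _ => norm_nonneg _) (fun n => ?_) (Summable.add hF hG)
  rw [map_add]
  exact norm_add_le _ _

theorem sub (hF : AbsSummable F) (hG : AbsSummable G) : AbsSummable (F - G) := by
  refine Summable.of_nonneg_of_le (fun _ => norm_nonneg _) (fun n => ?_) (Summable.add hF hG)
  rw [map_sub]
  exact norm_sub_le _ _

theorem mul (hF : AbsSummable F) (hG : AbsSummable G) : AbsSummable (F * G) := by
  simp only [AbsSummable, coeff_mul]
  exact summable_norm_sum_mul_antidiagonal_of_summable_norm (f := fun n => coeff n F)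
    (g := fun n => coeff n G) hF hG

theorem const (a : ℝ) : AbsSummable (C a) := by
  refine summable_of_ne_finset_zero (s := {0}) fun n hn => ?_
  rw [coeff_C, if_neg (by simpa using hn), norm_zero]

theorem of_X : AbsSummable (X : ℝ⟦X⟧) := by
  refine summable_of_ne_finset_zero (s := {1}) fun n hn => ?_
  rw [coeff_X, if_neg (by simpa using hn), norm_zero]

theorem one : AbsSummable 1 := by simpa using const 1

theorem pow (hF : AbsSummable F) (n : ℕ) : AbsSummable (F ^ n) := by
  induction n with
  | zero => simpa using one
  | succ n ih =>
    rw [pow_succ]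
    exact ih.mul hF

end AbsSummable

section evalOne

variable {F G : ℝ⟦X⟧}

theorem evalOne_add (hF : AbsSummable F) (hG : AbsSummable G) :
    evalOne (F + G) = evalOne F + evalOne G := by
  simp only [evalOne, map_add]
  exact hF.summable.tsum_add hG.summable

theorem evalOne_sub (hF : AbsSummable F) (hG : AbsSummable G) :
    evalOne (F - G) = evalOne F - evalOne G := by
  simp only [evalOne, map_sub]
  exact hF.summable.tsum_sub hG.summable

theorem evalOne_mul (hF : AbsSummable F) (hG : AbsSummable G) :
    evalOne (F * G) = evalOne F * evalOne G := by
  simp only [evalOne, coeff_mul]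
  exact (tsum_mul_tsum_eq_tsum_sum_antidiagonal_of_summable_norm hF hG).symm

@[simp]
theorem evalOne_C (a : ℝ) : evalOne (C a) = a := by
  rw [evalOne, tsum_eq_single 0 fun n hn => by rw [coeff_C, if_neg hn]]
  simp

@[simp]
theorem evalOne_one : evalOne 1 = 1 := by simpa using evalOne_C 1

@[simp]
theorem evalOne_X : evalOne X = 1 := by
  rw [evalOne, tsum_eq_single 1 fun n hn => by rw [coeff_X, if_neg hn]]
  simp

theorem evalOne_pow (hF : AbsSummable F) (n : ℕ) : evalOne (F ^ n) = evalOne F ^ n := by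
  induction n with
  | zero => simp
  | succ n ih => rw [pow_succ, pow_succ, evalOne_mul (hF.pow n) hF, ih]

theorem evalOne_nonneg (hF : CoeffNonneg F) : 0 ≤ evalOne F := tsum_nonneg hF

theorem absSummable_of_sum_le (hF : CoeffNonneg F) {c : ℝ}
    (h : ∀ N, ∑ n ∈ Finset.range N, coeff n F ≤ c) : AbsSummable F ∧ evalOne F ≤ c := by
  refine ⟨?_, Real.tsum_le_of_sum_range_le hF h⟩
  have := summable_of_sum_range_le hF h
  simpa only [AbsSummable, Real.norm_of_nonneg (hF _)] using this

theorem AbsSummable.of_sub_nonneg (hF : CoeffNonneg F) (hG : AbsSummable G)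
    (h : CoeffNonneg (G - F)) : AbsSummable F := by
  refine Summable.of_nonneg_of_le (fun _ => norm_nonneg _) (fun n => ?_) hG.summable
  rw [Real.norm_of_nonneg (hF n)]
  have := h n
  rw [map_sub] at this
  linarith

/-- The antidiagonals below `N` lie in the square of side `N`. Working with partial sums allows
bounds before summability is known. -/
theorem sum_range_coeff_mul_le (hF : CoeffNonneg F) (hG : CoeffNonneg G) (N : ℕ) :
    ∑ n ∈ Finset.range N, coeff n (F * G) ≤
      (∑ n ∈ Finset.range N, coeff n F) * ∑ n ∈ Finset.range N, coeff n G := by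
  simp only [coeff_mul]
  rw [Finset.sum_mul_sum, ← Finset.sum_product', Finset.sum_sigma']
  rw [← Finset.sum_image (f := fun p : ℕ × ℕ => coeff p.1 F * coeff p.2 G)
    (g := fun x : (_ : ℕ) × (ℕ × ℕ) => x.2)]
  · refine Finset.sum_le_sum_of_subset_of_nonneg ?_ fun p _ _ => mul_nonneg (hF _) (hG _)
    intro p hp
    simp only [Finset.mem_image, Finset.mem_sigma, Finset.mem_range] at hp
    obtain ⟨⟨n, p'⟩, ⟨hn, hp⟩, rfl⟩ := hp
    have hp := Finset.HasAntidiagonal.mem_antidiagonal.1 hp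
    simp only [Finset.mem_product, Finset.mem_range]
    dsimp only at hp hn ⊢
    omega
  · rintro ⟨n, p⟩ hp ⟨n', p'⟩ hp' h
    simp only [Finset.coe_sigma, Set.mem_sigma_iff, Finset.mem_coe] at hp hp'
    have h1 := Finset.HasAntidiagonal.mem_antidiagonal.1 hp.2
    have h2 := Finset.HasAntidiagonal.mem_antidiagonal.1 hp'.2
    dsimp only at h h1 h2
    subst h
    subst h1
    subst h2
    rfl

theorem coeff_mul_le (hF : CoeffNonneg F) (hFs : AbsSummable F) {M : ℝ}
    (hM : 0 ≤ M) (h : ∀ n, coeff n G ≤ M) (n : ℕ) : coeff n (F * G) ≤ evalOne F * M := by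
  rw [coeff_mul, Finset.Nat.sum_antidiagonal_eq_sum_range_succ
    (f := fun i j => coeff i F * coeff j G)]
  calc ∑ i ∈ Finset.range n.succ, coeff i F * coeff (n - i) G
      ≤ ∑ i ∈ Finset.range n.succ, coeff i F * M :=
        Finset.sum_le_sum fun i _ => mul_le_mul_of_nonneg_left (h _) (hF i)
    _ = (∑ i ∈ Finset.range n.succ, coeff i F) * M := by rw [Finset.sum_mul]
    _ ≤ evalOne F * M := by
        refine mul_le_mul_of_nonneg_right ?_ hM
        exact hFs.summable.sum_le_tsum _ fun i _ => hF i

/-- If `(1 - X) F` has absolutely summable coefficients then the coefficients of `F` converge to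
its value at one. -/
theorem tendsto_coeff_of_one_sub_X_mul (h : (1 - X) * F = G) (hG : AbsSummable G) :
    Tendsto (fun n => coeff n F) atTop (𝓝 (evalOne G)) := by
  have hsum : ∀ n, coeff n F = ∑ i ∈ Finset.range (n + 1), coeff i G := by
    intro n
    induction n with
    | zero =>
      rw [← h, sub_mul, one_mul]
      simp
    | succ n ih =>
      rw [Finset.sum_range_succ, ← ih, ← h, sub_mul, one_mul, map_sub, coeff_succ_X_mul]
      ring
  simp_rw [hsum]
  exact (hG.summable.hasSum.tendsto_sum_nat).comp (tendsto_add_atTop_nat 1)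

-- Tonelli's theorem for the double family of coefficients: with nonnegative entries,
-- coefficientwise convergence of `∑ Q m` together with convergence of the values at one gives
-- membership of the sum in the ring, and its value.
open scoped PowerSeries.WithPiTopology in
theorem absSummable_of_hasSum {Q : ℕ → ℝ⟦X⟧} (hQ : ∀ m, CoeffNonneg (Q m))
    (hQs : ∀ m, AbsSummable (Q m)) (hF : HasSum Q F) {a : ℝ}
    (ha : HasSum (fun m => evalOne (Q m)) a) :
    CoeffNonneg F ∧ AbsSummable F ∧ evalOne F = a := by
  have hc := (PowerSeries.WithPiTopology.hasSum_iff_hasSum_coeff ℝ).1 hF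
  have hF0 : CoeffNonneg F := fun n => (hc n).nonneg fun m => hQ m n
  have hs : Summable fun p : ℕ × ℕ => coeff p.2 (Q p.1) :=
    (summable_prod_of_nonneg fun p => hQ p.1 p.2).2 ⟨fun m => (hQs m).summable, ha.summable⟩
  have h1 : (fun n => coeff n F) = fun n => ∑' m, coeff n (Q m) :=
    funext fun n => (hc n).tsum_eq.symm
  refine ⟨hF0, ?_, ?_⟩
  · have : Summable fun n => coeff n F := by
      rw [h1]
      exact ((Equiv.prodComm ℕ ℕ).summable_iff.2 hs).prod
    simpa only [AbsSummable, Real.norm_of_nonneg (hF0 _)] using this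
  · rw [evalOne, h1, ← ha.tsum_eq]
    exact Summable.tsum_comm hs

end evalOne

end PowerSeries

namespace PlaneTree

open PowerSeries

/-! ### Asymptotics of the coefficients at the critical point -/

/-- The generating function of trees of height at most `m`, rescaled to have the critical point
at one. -/
noncomputable def scaledHeightSeries (k : ℝ) (m : ℕ) : ℝ⟦X⟧ :=
  rescale (criticalPoint k) (heightSeries m)

/-- The generating function of finite trees, rescaled to have the critical point at one. -/
noncomputable def scaledTreeSeries (k : ℝ) : ℝ⟦X⟧ := rescale (criticalPoint k) treeSeries

theorem criticalPoint_pos {k : ℝ} (hk : 1 < k) : 0 < criticalPoint k := by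
  rw [criticalPoint]
  positivity

section

variable {k : ℝ}

theorem scaledHeightSeries_zero : scaledHeightSeries k 0 = 0 := by
  rw [scaledHeightSeries, heightSeries_zero, map_zero]

theorem one_sub_mul_scaledHeightSeries_succ (m : ℕ) :
    (1 - scaledHeightSeries k m) * scaledHeightSeries k (m + 1) = C (criticalPoint k) * X := by
  rw [scaledHeightSeries, scaledHeightSeries, ← rescale_X, ← one_sub_mul_heightSeries_succ m]
  simp

theorem one_sub_mul_scaledTreeSeries :
    (1 - scaledTreeSeries k) * scaledTreeSeries k = C (criticalPoint k) * X := by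
  rw [scaledTreeSeries, ← rescale_X, ← one_sub_mul_treeSeries]
  simp

theorem scaledHeightSeries_one : scaledHeightSeries k 1 = C (criticalPoint k) * X := by
  have := one_sub_mul_scaledHeightSeries_succ (k := k) 0
  rwa [scaledHeightSeries_zero, sub_zero, one_mul] at this

theorem coeff_scaledHeightSeries_stable {m n : ℕ} (h : n ≤ m) :
    coeff n (scaledHeightSeries k m) = coeff n (scaledTreeSeries k) := by
  rw [scaledHeightSeries, scaledTreeSeries, coeff_rescale, coeff_rescale,
    coeff_heightSeries_stable h]

theorem coeffNonneg_scaledHeightSeries (hk : 1 < k) (m : ℕ) :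
    CoeffNonneg (scaledHeightSeries k m) := fun n => by
  rw [scaledHeightSeries, coeff_rescale, coeff_heightSeries]
  have := criticalPoint_pos hk
  positivity

theorem coeffNonneg_scaledTreeSeries (hk : 1 < k) : CoeffNonneg (scaledTreeSeries k) := fun n => by
  rw [← coeff_scaledHeightSeries_stable le_rfl]
  exact coeffNonneg_scaledHeightSeries hk n n

theorem coeffNonneg_scaledHeightSeries_sub (hk : 1 < k) {m m' : ℕ} (h : m ≤ m') :
    CoeffNonneg (scaledHeightSeries k m' - scaledHeightSeries k m) := fun n => by
  rw [scaledHeightSeries, scaledHeightSeries, map_sub, coeff_rescale, coeff_rescale,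
    coeff_heightSeries, coeff_heightSeries, ← mul_sub]
  have h1 := criticalPoint_pos hk
  have h2 : (countTrees m n : ℝ) ≤ countTrees m' n := by exact_mod_cast countTrees_mono h n
  have h3 := sub_nonneg.2 h2
  positivity

theorem coeffNonneg_scaledTreeSeries_sub (hk : 1 < k) (m : ℕ) :
    CoeffNonneg (scaledTreeSeries k - scaledHeightSeries k m) := fun n => by
  rw [map_sub, ← coeff_scaledHeightSeries_stable (le_max_right m n), ← map_sub]
  exact coeffNonneg_scaledHeightSeries_sub hk (le_max_left m n) n

theorem critical_identity (hk : 1 < k) : 1 / (1 + k) * (1 - 1 / (1 + k)) = criticalPoint k := by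
  rw [criticalPoint]
  have : 1 + k ≠ 0 := by linarith
  field_simp
  ring

/-- The number `u = 1/(1+k)` is a fixed point of `x ↦ g/(1-x)`. A bound by `u` at step `m` gives `S
≤ g + u S` for the next partial sum, and `g = u (1 - u)`. -/
theorem sum_coeff_scaledHeightSeries_le (hk : 1 < k) (m N : ℕ) :
    ∑ n ∈ Finset.range N, coeff n (scaledHeightSeries k m) ≤ 1 / (1 + k) := by
  have h0 : 0 < 1 / (1 + k) := by
    have : 0 < 1 + k := by linarith
    positivity
  have h1 : 1 / (1 + k) < 1 := by
    rw [div_lt_one (by linarith)]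
    linarith
  induction m with
  | zero =>
    rw [scaledHeightSeries_zero]
    simpa using h0.le
  | succ m ih =>
    have hx : scaledHeightSeries k (m + 1) = C (criticalPoint k) * X +
        scaledHeightSeries k m * scaledHeightSeries k (m + 1) := by
      rw [← one_sub_mul_scaledHeightSeries_succ m]
      ring
    have hg : ∑ n ∈ Finset.range N, coeff n (C (criticalPoint k) * X : ℝ⟦X⟧) ≤ criticalPoint k := by
      simp only [coeff_C_mul, coeff_X, mul_ite, mul_one, mul_zero, Finset.sum_ite_eq']
      split_ifs
      · exact le_rfl
      · exact (criticalPoint_pos hk).le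
    have h2 := sum_range_coeff_mul_le (coeffNonneg_scaledHeightSeries hk m)
      (coeffNonneg_scaledHeightSeries hk (m + 1)) N
    set S := ∑ n ∈ Finset.range N, coeff n (scaledHeightSeries k (m + 1)) with hS
    have hS0 : 0 ≤ S := Finset.sum_nonneg fun n _ => coeffNonneg_scaledHeightSeries hk (m + 1) n
    have h3 : S ≤ criticalPoint k + 1 / (1 + k) * S := by
      calc S = ∑ n ∈ Finset.range N, coeff n (C (criticalPoint k) * X : ℝ⟦X⟧) +
            ∑ n ∈ Finset.range N,
              coeff n (scaledHeightSeries k m * scaledHeightSeries k (m + 1)) := by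
            rw [← Finset.sum_add_distrib, hS]
            conv_lhs => rw [hx]
            simp only [map_add]
        _ ≤ _ := add_le_add hg (h2.trans (mul_le_mul_of_nonneg_right ih hS0))
    rw [← critical_identity hk] at h3
    have h4 : S * (1 - 1 / (1 + k)) ≤ 1 / (1 + k) * (1 - 1 / (1 + k)) := by linarith
    exact le_of_mul_le_mul_right h4 (by linarith)

theorem absSummable_scaledTreeSeries_and_le (hk : 1 < k) :
    AbsSummable (scaledTreeSeries k) ∧ evalOne (scaledTreeSeries k) ≤ 1 / (1 + k) := by
  refine absSummable_of_sum_le (coeffNonneg_scaledTreeSeries hk) fun N => ?_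
  refine le_trans (le_of_eq ?_) (sum_coeff_scaledHeightSeries_le hk N N)
  refine Finset.sum_congr rfl fun n hn => ?_
  rw [coeff_scaledHeightSeries_stable (Finset.mem_range.1 hn).le]

theorem absSummable_scaledTreeSeries (hk : 1 < k) : AbsSummable (scaledTreeSeries k) :=
  (absSummable_scaledTreeSeries_and_le hk).1

theorem evalOne_scaledTreeSeries (hk : 1 < k) : evalOne (scaledTreeSeries k) = 1 / (1 + k) := by
  have h1 := congrArg evalOne (one_sub_mul_scaledTreeSeries (k := k))
  have hs := absSummable_scaledTreeSeries hk
  rw [evalOne_mul (AbsSummable.one.sub hs) hs, evalOne_sub AbsSummable.one hs,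
    evalOne_mul (AbsSummable.const _) AbsSummable.of_X, evalOne_one, evalOne_C, evalOne_X,
    ← critical_identity hk] at h1
  have h2 := (absSummable_scaledTreeSeries_and_le hk).2
  have h3 : 1 / (1 + k) < 1 / 2 := one_div_lt_one_div_of_lt two_pos (by linarith)
  -- The equation `x (1 - x) = g` has the roots `1/(1+k)` and `k/(1+k)`; the upper bound excludes
  -- the larger one.
  have h4 : (evalOne (scaledTreeSeries k) - 1 / (1 + k)) *
      (1 - 1 / (1 + k) - evalOne (scaledTreeSeries k)) = 0 := by linear_combination h1
  rcases mul_eq_zero.1 h4 with h | h <;> linarith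

theorem absSummable_scaledHeightSeries (hk : 1 < k) (m : ℕ) :
    AbsSummable (scaledHeightSeries k m) :=
  AbsSummable.of_sub_nonneg (coeffNonneg_scaledHeightSeries hk m)
    (absSummable_scaledTreeSeries hk) (coeffNonneg_scaledTreeSeries_sub hk m)

/-- The closed form of the Möbius iteration `x ↦ g/(1-x)` started at 0, with fixed points `1/(1+k)`
and `k/(1+k)` and multiplier `1/k` at the first. -/
theorem evalOne_scaledHeightSeries (hk : 1 < k) (m : ℕ) :
    evalOne (scaledHeightSeries k m) = (k ^ (m + 1) - k) / ((1 + k) * (k ^ (m + 1) - 1)) := by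
  induction m with
  | zero => simp [scaledHeightSeries_zero, evalOne]
  | succ m ih =>
    have h1 := congrArg evalOne (one_sub_mul_scaledHeightSeries_succ (k := k) m)
    have hs := absSummable_scaledHeightSeries hk m
    rw [evalOne_mul (AbsSummable.one.sub hs) (absSummable_scaledHeightSeries hk _),
      evalOne_sub AbsSummable.one hs,
      evalOne_mul (AbsSummable.const _) AbsSummable.of_X, evalOne_one, evalOne_C, evalOne_X,
      ih, criticalPoint] at h1
    have h2 : 1 < k ^ (m + 1) := one_lt_pow₀ hk (by omega)
    have h3 : 1 < k ^ (m + 1 + 1) := one_lt_pow₀ hk (by omega)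
    have e1 : (1 + k) ≠ 0 := by linarith
    have e2 : k ^ (m + 1) - 1 ≠ 0 := by linarith
    have e3 : k ^ (m + 1 + 1) - 1 ≠ 0 := by linarith
    have h4 : 1 - (k ^ (m + 1) - k) / ((1 + k) * (k ^ (m + 1) - 1)) =
        (k ^ (m + 1 + 1) - 1) / ((1 + k) * (k ^ (m + 1) - 1)) := by
      field_simp
      ring
    have e4 : (k ^ (m + 1 + 1) - 1) / ((1 + k) * (k ^ (m + 1) - 1)) ≠ 0 :=
      div_ne_zero e3 (mul_ne_zero e1 e2)
    rw [h4] at h1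
    refine mul_left_cancel₀ e4 ?_
    rw [h1]
    field_simp
    ring

theorem sub_evalOne_scaledHeightSeries_le (hk : 1 < k) (m : ℕ) :
    k ^ (m + 1) * (1 / (1 + k) - evalOne (scaledHeightSeries k m)) ≤ k := by
  rw [evalOne_scaledHeightSeries hk]
  have h2 : k ≤ k ^ (m + 1) := le_self_pow₀ hk.le (by omega)
  have e1 : (1 + k) ≠ 0 := by linarith
  have e2 : k ^ (m + 1) - 1 ≠ 0 := by linarith
  have h3 : k ^ (m + 1) * (1 / (1 + k) - (k ^ (m + 1) - k) / ((1 + k) * (k ^ (m + 1) - 1))) =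
      (k ^ (m + 1) * (k - 1)) / ((1 + k) * (k ^ (m + 1) - 1)) := by
    field_simp
    ring
  rw [h3, div_le_iff₀ (mul_pos (by linarith) (by linarith))]
  have h5 : 0 ≤ (k ^ (m + 1) - k) * (k - 1) := mul_nonneg (by linarith) (by linarith)
  have h6 : 0 ≤ k ^ (m + 1) * (k * k) - k ^ (m + 1) := by
    have : 1 ≤ k * k := by nlinarith
    nlinarith
  have h7 : 0 ≤ (k ^ (m + 1) - k) * (k * k) := mul_nonneg (by linarith) (by positivity)
  nlinarith

/-- The increments decay exactly like the inverse of the weight. The nonzero limit is the source of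
the pole of the weighted series at the critical point. -/
theorem tendsto_evalOne_scaledHeightSeries_sub (hk : 1 < k) :
    Tendsto (fun m => k ^ (m + 1) *
      (evalOne (scaledHeightSeries k (m + 1)) - evalOne (scaledHeightSeries k m))) atTop
      (𝓝 ((k - 1) ^ 2 / (k * (1 + k)))) := by
  have hq : Tendsto (fun m : ℕ => (k ^ m)⁻¹) atTop (𝓝 0) :=
    tendsto_inv_atTop_zero.comp (tendsto_pow_atTop_atTop_of_one_lt hk)
  have h1 : Tendsto (fun m : ℕ => (1 - (k ^ m)⁻¹)) atTop (𝓝 1) := by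
    simpa using tendsto_const_nhds.sub hq
  have h2 := ((h1.comp (tendsto_add_atTop_nat 1)).mul (h1.comp (tendsto_add_atTop_nat 2)))
  have h3 := (tendsto_const_nhds (x := (k - 1) ^ 2 / (k * (1 + k)))).div h2 (by norm_num)
  rw [mul_one, div_one] at h3
  refine h3.congr fun m => ?_
  rw [evalOne_scaledHeightSeries hk, evalOne_scaledHeightSeries hk]
  simp only [Pi.div_apply, Function.comp]
  have h4 : 1 < k ^ (m + 1) := one_lt_pow₀ hk (by omega)
  have h5 : 1 < k ^ (m + 1 + 1) := one_lt_pow₀ hk (by omega)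
  have e0 : k ≠ 0 := by linarith
  have e1 : (1 + k) ≠ 0 := by linarith
  have e2 : k ^ (m + 1) - 1 ≠ 0 := by linarith
  have e3 : k ^ (m + 1 + 1) - 1 ≠ 0 := by linarith
  have e4 : k ^ (m + 1) ≠ 0 := by positivity
  have h6 : (1 - (k ^ (m + 1))⁻¹) * (1 - (k ^ (m + 2))⁻¹) =
      (k ^ (m + 1) - 1) * (k ^ (m + 1 + 1) - 1) / (k ^ (m + 1) * k ^ (m + 1 + 1)) := by
    field_simp
  rw [h6]
  field_simp
  ring

end

end PlaneTree

/-! ### The height-weighted generating function and its pole at the critical point -/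

namespace PlaneTree

open PowerSeries

/-- The generating function of `K`-tuples of trees, weighted by `k` to the power of the maximal
height, rescaled to have the critical point at one. -/
noncomputable def tiltedSeries (k : ℝ) (K : ℕ) : ℝ⟦X⟧ := PowerSeries.mk fun n =>
  ∑' m : ℕ, k ^ (m + 1) * coeff n (scaledHeightSeries k (m + 1) ^ K - scaledHeightSeries k m ^ K)

section

variable {k : ℝ}

open scoped PowerSeries.WithPiTopology

/-- Each coefficient receives only finitely many nonzero terms, because coefficient `n` no longer
depends on the height bound from `m = n` on. -/
theorem hasSum_tiltedSeries (K : ℕ) :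
    HasSum (fun m : ℕ => C (k ^ (m + 1)) *
      (scaledHeightSeries k (m + 1) ^ K - scaledHeightSeries k m ^ K)) (tiltedSeries k K) := by
  refine (PowerSeries.WithPiTopology.hasSum_iff_hasSum_coeff ℝ).2 fun n => ?_
  simp only [coeff_C_mul, tiltedSeries, coeff_mk]
  refine Summable.hasSum (summable_of_ne_finset_zero (s := Finset.range n) fun m hm => ?_)
  have hm : n ≤ m := by simpa using hm
  rw [map_sub, sub_eq_zero.2, mul_zero]
  refine coeff_pow_congr (fun i hi => ?_) K
  rw [coeff_scaledHeightSeries_stable (by omega), coeff_scaledHeightSeries_stable (by omega)]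

/-- The reciprocal of `1 - F`, for the generating functions `F` of trees of bounded height. -/
theorem exists_inverse (hk : 1 < k) (m : ℕ) : ∃ Y : ℝ⟦X⟧, (1 - scaledHeightSeries k m) * Y = 1 ∧
    scaledHeightSeries k (m + 1) = C (criticalPoint k) * X * Y ∧ CoeffNonneg Y := by
  have h0 : constantCoeff (1 - scaledHeightSeries k m) ≠ 0 := by
    rw [← coeff_zero_eq_constantCoeff_apply, map_sub, scaledHeightSeries, coeff_rescale,
      coeff_heightSeries, countTrees_zero_right]
    simp
  have h1 := PowerSeries.mul_inv_cancel _ h0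
  have h2 : scaledHeightSeries k (m + 1) =
      C (criticalPoint k) * X * (1 - scaledHeightSeries k m)⁻¹ := by
    rw [← one_sub_mul_scaledHeightSeries_succ m]
    linear_combination -scaledHeightSeries k (m + 1) * h1
  refine ⟨_, h1, h2, fun n => ?_⟩
  have h3 := coeffNonneg_scaledHeightSeries hk (m + 1) (n + 1)
  rw [h2, mul_assoc, coeff_C_mul, coeff_succ_X_mul] at h3
  exact nonneg_of_mul_nonneg_right h3 (criticalPoint_pos hk)

/-- Summability of the reciprocal comes for free: up to the constant `g` and a shift of index, its
coefficients are those of the tree series itself. -/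
theorem exists_inverse_treeSeries (hk : 1 < k) : ∃ Y : ℝ⟦X⟧, (1 - scaledTreeSeries k) * Y = 1 ∧
    scaledTreeSeries k = C (criticalPoint k) * X * Y ∧ AbsSummable Y := by
  have h0 : constantCoeff (1 - scaledTreeSeries k) ≠ 0 := by
    rw [← coeff_zero_eq_constantCoeff_apply, map_sub, scaledTreeSeries, coeff_rescale,
      coeff_treeSeries, countTrees_zero_right]
    simp
  have h1 := PowerSeries.mul_inv_cancel _ h0
  have h2 : scaledTreeSeries k = C (criticalPoint k) * X * (1 - scaledTreeSeries k)⁻¹ := by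
    rw [← one_sub_mul_scaledTreeSeries]
    linear_combination -scaledTreeSeries k * h1
  refine ⟨_, h1, h2, ?_⟩
  have h3 := (summable_nat_add_iff 1).2 (absSummable_scaledTreeSeries hk)
  have h4 : ∀ n, ‖coeff n (1 - scaledTreeSeries k)⁻¹‖ =
      (criticalPoint k)⁻¹ * ‖coeff (n + 1) (scaledTreeSeries k)‖ := by
    intro n
    conv_rhs => rw [h2]
    rw [mul_assoc, coeff_C_mul, coeff_succ_X_mul, norm_mul,
      Real.norm_of_nonneg (criticalPoint_pos hk).le, inv_mul_cancel_left₀ (criticalPoint_pos hk).ne']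
  simp only [AbsSummable, h4]
  exact h3.mul_left _

theorem coeffNonneg_of_C_mul_X_mul (hk : 1 < k) {F : ℝ⟦X⟧}
    (h : CoeffNonneg (C (criticalPoint k) * X * F)) : CoeffNonneg F := fun n => by
  have h3 := h (n + 1)
  rw [mul_assoc, coeff_C_mul, coeff_succ_X_mul] at h3
  exact nonneg_of_mul_nonneg_right h3 (criticalPoint_pos hk)

/-- Increments of the generating functions decrease at least by the factor `F`, where
`F = g (1 + F)²`. -/
theorem exists_contraction (hk : 1 < k) : ∃ F : ℝ⟦X⟧, AbsSummable F ∧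
    F = C (criticalPoint k) * X * (1 + F) ^ 2 ∧ evalOne F = 1 / k ∧
    ∀ m, CoeffNonneg (F * (scaledHeightSeries k (m + 1) - scaledHeightSeries k m) -
      (scaledHeightSeries k (m + 2) - scaledHeightSeries k (m + 1))) := by
  obtain ⟨Y, hY1, hY2, hYs⟩ := exists_inverse_treeSeries hk
  set c := scaledTreeSeries k with hc
  set G := C (criticalPoint k) * X with hG
  have hYc : Y = 1 + G * Y ^ 2 := by linear_combination hY1 + Y * hY2
  have hcs := absSummable_scaledTreeSeries hk
  -- With `c` the tree series, `F = c / (1 - c)`, which also equals `G Y ^ 2`.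
  refine ⟨Y - 1, hYs.sub AbsSummable.one, by linear_combination hYc, ?_, fun m => ?_⟩
  · have h1 := congrArg evalOne hY1
    rw [evalOne_mul (AbsSummable.one.sub hcs) hYs, evalOne_sub AbsSummable.one hcs, evalOne_one,
      evalOne_scaledTreeSeries hk] at h1
    rw [evalOne_sub hYs AbsSummable.one, evalOne_one]
    have e0 : k ≠ 0 := by linarith
    have e1 : 1 + k ≠ 0 := by linarith
    field_simp at h1 ⊢
    linear_combination h1
  · obtain ⟨Y₁, h11, h12, h13⟩ := exists_inverse hk m
    obtain ⟨Y₂, h21, h22, h23⟩ := exists_inverse hk (m + 1)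
    have hd1 : CoeffNonneg (Y - Y₁) := by
      refine coeffNonneg_of_C_mul_X_mul hk ?_
      rw [mul_sub, ← hG, ← hY2, ← h12]
      exact coeffNonneg_scaledTreeSeries_sub hk (m + 1)
    have hd2 : CoeffNonneg (Y - Y₂) := by
      refine coeffNonneg_of_C_mul_X_mul hk ?_
      rw [mul_sub, ← hG, ← hY2, ← h22]
      exact coeffNonneg_scaledTreeSeries_sub hk (m + 2)
    have hYn : CoeffNonneg Y := by
      have := h13.add hd1
      rwa [add_sub_cancel] at this
    have hp := coeffNonneg_scaledHeightSeries_sub hk (Nat.le_succ m)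
    have hGn : CoeffNonneg G := by
      rw [hG, ← scaledHeightSeries_one]
      exact coeffNonneg_scaledHeightSeries hk 1
    -- Subtracting two consecutive recursions shows that the new increment is `G Y₁ Y₂` times the
    -- old one, while `F = G Y ^ 2` and `Y` dominates both `Y₁` and `Y₂` coefficientwise.
    have key : (Y - 1) * (scaledHeightSeries k (m + 1) - scaledHeightSeries k m) -
        (scaledHeightSeries k (m + 2) - scaledHeightSeries k (m + 1)) =
        G * (Y * Y - Y₁ * Y₂) * (scaledHeightSeries k (m + 1) - scaledHeightSeries k m) := by
      linear_combination (scaledHeightSeries k (m + 1) - scaledHeightSeries k m) * hYc -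
        h22 + h12 + G * Y₂ * h11 - G * Y₁ * h21
    rw [key]
    exact (hGn.mul (CoeffNonneg.mul_sub_mul h13 hYn hd1 hd2)).mul hp

/-- The limit of the rescaled partition functions. -/
noncomputable def tiltedLimit (k : ℝ) : ℝ := (k - 1) ^ 3 / (k * (1 + k) ^ 2)

theorem tiltedLimit_pos (hk : 1 < k) : 0 < tiltedLimit k := by
  have : 0 < k - 1 := by linarith
  rw [tiltedLimit]
  positivity

/-- With increments `p m` and `W` the weighted series, `(1 - k F) W = k p 0 - E`, where `E = ∑
k^(m+2) (F p m - p (m+1))` has nonnegative coefficients and telescoping values. So `(1 - k F) W` is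
absolutely summable. Since `F` takes the value `1/k` at one, `1 - k F` vanishes there; it divides `1
- X` with a cofactor in the ring, which moves the zero to an explicit factor. -/
theorem exists_one_sub_X_mul_tiltedSeries_one (hk : 1 < k) : ∃ B : ℝ⟦X⟧, AbsSummable B ∧
    (1 - X) * tiltedSeries k 1 = B ∧ evalOne B = tiltedLimit k := by
  obtain ⟨F, hFs, hF, hFe, hR⟩ := exists_contraction hk
  have e0 : k ≠ 0 := by linarith
  have e1 : 1 + k ≠ 0 := by linarith
  set g := criticalPoint k with hg
  set p : ℕ → ℝ⟦X⟧ := fun m => scaledHeightSeries k (m + 1) - scaledHeightSeries k m with hp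
  have hps : ∀ m, AbsSummable (p m) := fun m =>
    (absSummable_scaledHeightSeries hk _).sub (absSummable_scaledHeightSeries hk _)
  have hp0 : p 0 = C g * X := by
    simp only [hp, zero_add, scaledHeightSeries_one, scaledHeightSeries_zero, sub_zero, hg]
  have hw := hasSum_tiltedSeries (k := k) 1
  simp only [pow_one] at hw
  have hw1 := (hasSum_nat_add_iff' 1).2 hw
  rw [Finset.sum_range_one] at hw1
  have hw2 := (hw.mul_left (C k * F)).sub hw1
  set E := C k * F * tiltedSeries k 1 - (tiltedSeries k 1 - C (k ^ (0 + 1)) *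
    (scaledHeightSeries k (0 + 1) - scaledHeightSeries k 0)) with hE
  have hterm : ∀ m : ℕ, C k * F * (C (k ^ (m + 1)) * p m) - C (k ^ (m + 1 + 1)) * p (m + 1) =
      C (k ^ (m + 2)) * (F * p m - p (m + 1)) := by
    intro m
    rw [show k ^ (m + 1 + 1) = k * k ^ (m + 1) by ring, map_mul]
    ring
  have hw3 : HasSum (fun m : ℕ => C (k ^ (m + 2)) * (F * p m - p (m + 1))) E := by
    simpa only [← hterm] using hw2
  have hQs : ∀ m, AbsSummable (C (k ^ (m + 2)) * (F * p m - p (m + 1))) := fun m =>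
    (AbsSummable.const _).mul ((hFs.mul (hps m)).sub (hps (m + 1)))
  have hQ : ∀ m, CoeffNonneg (C (k ^ (m + 2)) * (F * p m - p (m + 1))) := fun m =>
    (CoeffNonneg.const (by positivity)).mul (hR m)
  set v : ℕ → ℝ := fun m => k ^ (m + 1) * evalOne (p m) with hv
  have hvlim : Tendsto v atTop (𝓝 ((k - 1) ^ 2 / (k * (1 + k)))) := by
    refine (tendsto_evalOne_scaledHeightSeries_sub hk).congr fun m => ?_
    simp only [hv, hp]
    rw [evalOne_sub (absSummable_scaledHeightSeries hk _) (absSummable_scaledHeightSeries hk _)]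
  -- Because `F` has value `1/k`, the values telescope; their sum converges since `v` does.
  have hev : ∀ m, evalOne (C (k ^ (m + 2)) * (F * p m - p (m + 1))) = v m - v (m + 1) := by
    intro m
    rw [evalOne_mul (AbsSummable.const _) ((hFs.mul (hps m)).sub (hps (m + 1))),
      evalOne_sub (hFs.mul (hps m)) (hps (m + 1)), evalOne_mul hFs (hps m), evalOne_C, hFe]
    simp only [hv]
    field_simp
    ring
  have ha : HasSum (fun m => evalOne (C (k ^ (m + 2)) * (F * p m - p (m + 1))))
      (v 0 - (k - 1) ^ 2 / (k * (1 + k))) := by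
    rw [hasSum_iff_tendsto_nat_of_nonneg fun m => evalOne_nonneg (hQ m)]
    simp_rw [hev, Finset.sum_range_sub']
    exact tendsto_const_nhds.sub hvlim
  obtain ⟨-, hEs, hEe⟩ := absSummable_of_hasSum hQ hQs hw3 ha
  have hv0 : v 0 = k * g := by
    simp only [hv, hp0]
    rw [evalOne_mul (AbsSummable.const _) AbsSummable.of_X, evalOne_C, evalOne_X]
    ring
  have hXs : ∀ a, AbsSummable (C a * X) := fun a => (AbsSummable.const a).mul AbsSummable.of_X
  have hXe : ∀ a, evalOne (C a * X) = a := fun a => by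
    rw [evalOne_mul (AbsSummable.const _) AbsSummable.of_X, evalOne_C, evalOne_X, mul_one]
  have hU : AbsSummable (1 - C (2 * g + g / k) * X - C g * X * F) :=
    (AbsSummable.one.sub (hXs _)).sub ((hXs _).mul hFs)
  have hA : AbsSummable (C (k * g) * X - E) := (hXs _).sub hEs
  -- The first factor is the cofactor of `1 - k F` in `1 - X`. The polynomial `g X (1 + y)^2 - y`
  -- vanishes at `y = F` and equals `(X - 1)/k` at `y = 1/k`; dividing the difference by `1/k - F`
  -- produces it.
  refine ⟨(1 - C (2 * g + g / k) * X - C g * X * F) * (C (k * g) * X - E), hU.mul hA, ?_, ?_⟩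
  · have hgk : (1 : ℝ⟦X⟧) = C (k * g) + C (2 * g + g / k) := by
      rw [← map_add, ← map_one (C (R := ℝ))]
      congr 1
      rw [hg, criticalPoint]
      field_simp
      ring
    have hkg : (C k : ℝ⟦X⟧) * C (2 * g + g / k) = 2 * C (k * g) + C g := by
      have : (2 : ℝ⟦X⟧) = C 2 := (map_ofNat C 2).symm
      rw [this, ← map_mul, ← map_mul, ← map_add]
      congr 1
      field_simp
    have hkg' : (C (k * g) : ℝ⟦X⟧) = C k * C g := map_mul _ _ _
    have hA' : C (k * g) * X - E = (1 - C k * F) * tiltedSeries k 1 := by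
      rw [hE, zero_add, scaledHeightSeries_one, scaledHeightSeries_zero, pow_one, ← hg, hkg']
      ring
    rw [hA']
    linear_combination (tiltedSeries k 1) * (-X * hgk - X * F * hkg - X * (1 + 2 * F) * hkg' +
      C k * hF)
  · rw [evalOne_mul hU hA, evalOne_sub (hXs _) hEs,
      evalOne_sub (AbsSummable.one.sub (hXs _)) ((hXs _).mul hFs),
      evalOne_sub AbsSummable.one (hXs _), evalOne_mul (hXs _) hFs, hEe, hFe, hXe, hXe, hXe,
      evalOne_one, hv0, hg, criticalPoint, tiltedLimit]
    field_simp
    ring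

end

end PlaneTree

/-! ### Tuples of trees weighted by their maximal height -/

namespace PlaneTree

open PowerSeries

theorem pow_sub_pow_le {t u : ℝ} (ht : 0 ≤ t) (htu : t ≤ u) (hu : u ≤ 1) (n : ℕ) :
    u ^ n - t ^ n ≤ n * (u - t) := by
  rw [← geom_sum₂_mul]
  refine mul_le_mul_of_nonneg_right ?_ (sub_nonneg.2 htu)
  calc ∑ i ∈ Finset.range n, u ^ i * t ^ (n - 1 - i)
      ≤ ∑ i ∈ Finset.range n, (1 : ℝ) := Finset.sum_le_sum fun i _ =>
        mul_le_one₀ (pow_le_one₀ (ht.trans htu) hu) (pow_nonneg ht _)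
          (pow_le_one₀ ht (htu.trans hu))
    _ = n := by simp

section

variable {k : ℝ}

open scoped PowerSeries.WithPiTopology

theorem evalOne_scaledHeightSeries_mono (hk : 1 < k) {m m' : ℕ} (h : m ≤ m') :
    evalOne (scaledHeightSeries k m) ≤ evalOne (scaledHeightSeries k m') := by
  have := evalOne_nonneg (coeffNonneg_scaledHeightSeries_sub hk h)
  rw [evalOne_sub (absSummable_scaledHeightSeries hk _) (absSummable_scaledHeightSeries hk _)]
    at this
  linarith

theorem evalOne_scaledHeightSeries_le (hk : 1 < k) (m : ℕ) :
    evalOne (scaledHeightSeries k m) ≤ 1 / (1 + k) := by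
  have := evalOne_nonneg (coeffNonneg_scaledTreeSeries_sub hk m)
  rw [evalOne_sub (absSummable_scaledTreeSeries hk) (absSummable_scaledHeightSeries hk _),
    evalOne_scaledTreeSeries hk] at this
  linarith

/-- Up to a summable error, a `K`-tuple of trees weighted by its maximal height consists of one
weighted tree and `K - 1` unweighted ones. -/
theorem tiltedSeries_error (hk : 1 < k) (j : ℕ) :
    CoeffNonneg (C ((j + 1 : ℕ) : ℝ) * scaledTreeSeries k ^ j * tiltedSeries k 1 -
      tiltedSeries k (j + 1)) ∧
    AbsSummable (C ((j + 1 : ℕ) : ℝ) * scaledTreeSeries k ^ j * tiltedSeries k 1 -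
      tiltedSeries k (j + 1)) := by
  set c := scaledTreeSeries k with hc
  set x := scaledHeightSeries k with hx
  have hcn := coeffNonneg_scaledTreeSeries hk
  have hxn := coeffNonneg_scaledHeightSeries hk
  have hcs := absSummable_scaledTreeSeries hk
  have hxs := absSummable_scaledHeightSeries hk
  have hw1 := (hasSum_tiltedSeries (k := k) 1).mul_left (C ((j + 1 : ℕ) : ℝ) * c ^ j)
  have hw := hw1.sub (hasSum_tiltedSeries (k := k) (j + 1))
  -- By `x^(j+1) - y^(j+1) = (x - y) ∑ x^i y^(j-i)`, the error at height `m + 1` is the increment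
  -- times the defect from replacing each of the `j + 1` summands by `c ^ j`.
  set S : ℕ → ℝ⟦X⟧ := fun m => ∑ i ∈ Finset.range (j + 1), (c ^ j - x (m + 1) ^ i * x m ^ (j - i))
    with hS
  have hterm : ∀ m, C ((j + 1 : ℕ) : ℝ) * c ^ j * (C (k ^ (m + 1)) * (x (m + 1) ^ 1 - x m ^ 1)) -
      C (k ^ (m + 1)) * (x (m + 1) ^ (j + 1) - x m ^ (j + 1)) =
      C (k ^ (m + 1)) * (S m * (x (m + 1) - x m)) := by
    intro m
    have hgeom := geom_sum₂_mul (x (m + 1)) (x m) (j + 1)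
    simp only [Nat.add_sub_cancel] at hgeom
    rw [← hgeom, hS]
    simp only [Finset.sum_sub_distrib, Finset.sum_const, Finset.card_range, nsmul_eq_mul,
      map_natCast]
    ring
  replace hw := hw.congr_fun fun m => (hterm m).symm
  have hSn : ∀ m, CoeffNonneg (S m) := fun m => CoeffNonneg.sum fun i hi => by
    have hi : i ≤ j := by simpa [Nat.lt_succ_iff] using hi
    have : c ^ j = c ^ i * c ^ (j - i) := by rw [← pow_add]; congr 1; omega
    rw [this]
    exact CoeffNonneg.mul_sub_mul ((hxn _).pow _) (hcn.pow _)
      (CoeffNonneg.pow_sub_pow (hxn _) hcn (coeffNonneg_scaledTreeSeries_sub hk _) _)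
      (CoeffNonneg.pow_sub_pow (hxn _) hcn (coeffNonneg_scaledTreeSeries_sub hk _) _)
  -- The range is freed from `j` for the induction; truncated exponents `j - i` beyond `j` occur
  -- identically on both sides.
  have hsum : ∀ (m n : ℕ), AbsSummable
      (∑ i ∈ Finset.range n, (c ^ j - x (m + 1) ^ i * x m ^ (j - i))) ∧
      evalOne (∑ i ∈ Finset.range n, (c ^ j - x (m + 1) ^ i * x m ^ (j - i))) =
      ∑ i ∈ Finset.range n,
        ((1 / (1 + k)) ^ j - evalOne (x (m + 1)) ^ i * evalOne (x m) ^ (j - i)) := by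
    intro m n
    induction n with
    | zero => simpa [evalOne] using AbsSummable.const 0
    | succ n ih =>
      have hm := ((hxs (m + 1)).pow n).mul ((hxs m).pow (j - n))
      rw [Finset.sum_range_succ, Finset.sum_range_succ]
      refine ⟨ih.1.add ((hcs.pow j).sub hm), ?_⟩
      rw [evalOne_add ih.1 ((hcs.pow j).sub hm), ih.2, evalOne_sub (hcs.pow j) hm,
        evalOne_mul ((hxs (m + 1)).pow n) ((hxs m).pow (j - n)), evalOne_pow hcs,
        evalOne_pow (hxs _), evalOne_pow (hxs _), evalOne_scaledTreeSeries hk]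
  have hQs : ∀ m, AbsSummable (C (k ^ (m + 1)) * (S m * (x (m + 1) - x m))) := fun m =>
    (AbsSummable.const _).mul ((hsum m _).1.mul ((hxs _).sub (hxs _)))
  have hQn : ∀ m, CoeffNonneg (C (k ^ (m + 1)) * (S m * (x (m + 1) - x m))) := fun m =>
    (CoeffNonneg.const (by positivity)).mul
      ((hSn m).mul (coeffNonneg_scaledHeightSeries_sub hk (Nat.le_succ m)))
  have hu1 : 1 / (1 + k) ≤ 1 := by
    rw [div_le_one (by linarith)]
    linarith
  -- Both the defect `S m` and the increment are at most of order `k^(-m)`, so one factor `k^(-m)`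
  -- survives the weight `k^(m+1)`.
  have hbound : ∀ m, evalOne (C (k ^ (m + 1)) * (S m * (x (m + 1) - x m))) ≤
      ((j + 1 : ℕ) * j * k * k) * (k⁻¹) ^ (m + 1) := by
    intro m
    rw [evalOne_mul (AbsSummable.const _) ((hsum m _).1.mul ((hxs _).sub (hxs _))), evalOne_C,
      evalOne_mul (hsum m _).1 ((hxs _).sub (hxs _)), evalOne_sub (hxs _) (hxs _), (hsum m _).2]
    have ht0 : 0 ≤ evalOne (x m) := evalOne_nonneg (hxn m)
    have htt : evalOne (x m) ≤ evalOne (x (m + 1)) := evalOne_scaledHeightSeries_mono hk (by omega)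
    have htu : evalOne (x m) ≤ 1 / (1 + k) := evalOne_scaledHeightSeries_le hk m
    have htu' : evalOne (x (m + 1)) ≤ 1 / (1 + k) := evalOne_scaledHeightSeries_le hk _
    have hle : k ^ (m + 1) * (1 / (1 + k) - evalOne (x m)) ≤ k :=
      sub_evalOne_scaledHeightSeries_le hk m
    set t := evalOne (x m)
    set t' := evalOne (x (m + 1))
    set u := 1 / (1 + k)
    have h1 : ∑ i ∈ Finset.range (j + 1), (u ^ j - t' ^ i * t ^ (j - i)) ≤
        (j + 1 : ℕ) * (j * (u - t)) := by
      calc ∑ i ∈ Finset.range (j + 1), (u ^ j - t' ^ i * t ^ (j - i))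
          ≤ ∑ i ∈ Finset.range (j + 1), (j * (u - t)) := by
            refine Finset.sum_le_sum fun i hi => ?_
            have hi : i ≤ j := by simpa [Nat.lt_succ_iff] using hi
            have h2 : t ^ j ≤ t' ^ i * t ^ (j - i) := by
              calc t ^ j = t ^ i * t ^ (j - i) := by rw [← pow_add]; congr 1; omega
                _ ≤ _ := mul_le_mul_of_nonneg_right (pow_le_pow_left₀ ht0 htt i)
                    (pow_nonneg ht0 _)
            have := pow_sub_pow_le ht0 htu hu1 j
            linarith
        _ = _ := by rw [Finset.sum_const, Finset.card_range, nsmul_eq_mul]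
    have hkp : (0 : ℝ) < k ^ (m + 1) := by positivity
    have hu2 : u - t ≤ k * (k⁻¹) ^ (m + 1) := by
      rw [inv_pow, ← div_eq_mul_inv, le_div_iff₀ hkp]
      linarith
    have hut : 0 ≤ u - t := sub_nonneg.2 htu
    have hdt : 0 ≤ t' - t := sub_nonneg.2 htt
    calc k ^ (m + 1) * ((∑ i ∈ Finset.range (j + 1), (u ^ j - t' ^ i * t ^ (j - i))) * (t' - t))
        ≤ k ^ (m + 1) * (((j + 1 : ℕ) * (j * (u - t))) * (u - t)) := by
          refine mul_le_mul_of_nonneg_left ?_ hkp.le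
          exact mul_le_mul h1 (by linarith) hdt (by positivity)
      _ = ((j + 1 : ℕ) * j) * (u - t) * (k ^ (m + 1) * (u - t)) := by ring
      _ ≤ ((j + 1 : ℕ) * j) * (k * (k⁻¹) ^ (m + 1)) * k := by
          refine mul_le_mul ?_ hle (by positivity) (by positivity)
          exact mul_le_mul_of_nonneg_left hu2 (by positivity)
      _ = _ := by ring
  have hsummable : Summable fun m => evalOne (C (k ^ (m + 1)) * (S m * (x (m + 1) - x m))) := by
    refine Summable.of_nonneg_of_le (fun m => evalOne_nonneg (hQn m)) hbound ?_
    have hg := summable_geometric_of_lt_one (r := k⁻¹) (by positivity) (inv_lt_one_of_one_lt₀ hk)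
    exact ((summable_nat_add_iff 1).2 hg).mul_left _
  obtain ⟨h1, h2, -⟩ := absSummable_of_hasSum hQn hQs hw hsummable.hasSum
  exact ⟨h1, h2⟩

/-- After multiplication by `1 - X` the error has value 0 at one, so only `K X^(K-1) W_1`
contributes to the limit. -/
theorem tendsto_coeff_tiltedSeries (hk : 1 < k) (j : ℕ) :
    Tendsto (fun n => coeff n (tiltedSeries k (j + 1))) atTop
      (𝓝 ((j + 1 : ℕ) * (1 / (1 + k)) ^ j * tiltedLimit k)) := by
  obtain ⟨B, hBs, hB, hBe⟩ := exists_one_sub_X_mul_tiltedSeries_one hk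
  obtain ⟨-, hD⟩ := tiltedSeries_error hk j
  set D := C ((j + 1 : ℕ) : ℝ) * scaledTreeSeries k ^ j * tiltedSeries k 1 - tiltedSeries k (j + 1)
    with hDdef
  have hcs := absSummable_scaledTreeSeries hk
  have h1 : (1 - X) * tiltedSeries k (j + 1) =
      C ((j + 1 : ℕ) : ℝ) * scaledTreeSeries k ^ j * B - (1 - X) * D := by
    rw [hDdef, ← hB]
    ring
  have hs1 : AbsSummable (C ((j + 1 : ℕ) : ℝ) * scaledTreeSeries k ^ j) :=
    (AbsSummable.const _).mul (hcs.pow j)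
  have hs2 : AbsSummable (1 - X : ℝ⟦X⟧) := AbsSummable.one.sub AbsSummable.of_X
  convert tendsto_coeff_of_one_sub_X_mul h1 ((hs1.mul hBs).sub (hs2.mul hD)) using 2
  rw [evalOne_sub (hs1.mul hBs) (hs2.mul hD), evalOne_mul hs1 hBs, evalOne_mul hs2 hD,
    evalOne_sub AbsSummable.one AbsSummable.of_X, evalOne_mul (AbsSummable.const _) (hcs.pow j),
    evalOne_pow hcs, evalOne_C, evalOne_one, evalOne_X, hBe, evalOne_scaledTreeSeries hk]
  ring

/-- The sign of the error bounds `W_K` coefficientwise by `K X^(K-1) W_1`. This gives a constant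
independent of both `j` and `n`, as tightness requires. -/
theorem exists_coeff_tiltedSeries_le (hk : 1 < k) : ∃ M : ℝ, 0 ≤ M ∧ ∀ j n : ℕ,
    coeff n (tiltedSeries k (j + 1)) ≤ (j + 1 : ℕ) * (1 / (1 + k)) ^ j * M := by
  obtain ⟨M, hM⟩ := (tendsto_coeff_tiltedSeries hk 0).bddAbove_range
  have hcn := coeffNonneg_scaledTreeSeries hk
  have hcs := absSummable_scaledTreeSeries hk
  refine ⟨max M 0, le_max_right _ _, fun j n => ?_⟩
  have h1 := (tiltedSeries_error hk j).1 n
  rw [map_sub, sub_nonneg] at h1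
  refine h1.trans ?_
  have h2 := coeff_mul_le (G := tiltedSeries k 1)
    ((CoeffNonneg.const (Nat.cast_nonneg (j + 1))).mul (hcn.pow j))
    ((AbsSummable.const _).mul (hcs.pow j)) (le_max_right M 0)
    (fun n => (hM ⟨n, rfl⟩).trans (le_max_left _ _)) n
  rwa [evalOne_mul (AbsSummable.const _) (hcs.pow j), evalOne_pow hcs, evalOne_C,
    evalOne_scaledTreeSeries hk] at h2

end

/-! ### Weights of cylinders -/

/-- Induction on `c = X + c^2`, keeping only the product of coefficients `1` and `n + 1`. It makes
the partition functions positive. -/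
theorem countTrees_self_pos (n : ℕ) : 0 < countTrees (n + 1) (n + 1) := by
  have h : treeSeries = X + treeSeries * treeSeries := by
    linear_combination one_sub_mul_treeSeries
  have h0 : CoeffNonneg treeSeries := fun i => by
    rw [coeff_treeSeries]
    positivity
  have h1 : 0 < coeff 1 treeSeries := by
    rw [h, map_add, coeff_one_X]
    exact add_pos_of_pos_of_nonneg one_pos ((h0.mul h0) 1)
  have key : 0 < coeff (n + 1) treeSeries := by
    induction n with
    | zero => exact h1
    | succ n ih =>
      rw [h, map_add, coeff_X, if_neg (by omega), zero_add, coeff_mul]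
      refine lt_of_lt_of_le (mul_pos h1 ih) ?_
      exact Finset.single_le_sum (f := fun p : ℕ × ℕ => coeff p.1 treeSeries * coeff p.2 treeSeries)
        (a := (1, n + 1)) (fun p _ => mul_nonneg (h0 _) (h0 _))
        (Finset.HasAntidiagonal.mem_antidiagonal.2 (by simp only; omega))
  rw [coeff_treeSeries] at key
  exact_mod_cast key

theorem treesOfSize_nonempty (n : ℕ) : (treesOfSize (n + 1)).Nonempty := by
  rw [← Finset.card_pos, ← countTrees_self]
  exact countTrees_self_pos n

-- The bracket counts trees of height exactly `s + m + 1`, so `T` contributes only at `m = h(T) - (s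
-- + 1)`.
open Classical in
theorem hasSum_pow_height (k : ℝ) (s : ℕ) (S : Finset PlaneTree)
    (hS : ∀ T ∈ S, (s + 1 : ℕ) ≤ T.height ∧ T.height ≠ ⊤) :
    HasSum (fun m : ℕ => k ^ (s + m + 1) *
      (((S.filter fun T : PlaneTree => T.height ≤ ((s + (m + 1) : ℕ) : ℕ∞)).card : ℝ) -
        (S.filter fun T : PlaneTree => T.height ≤ ((s + m : ℕ) : ℕ∞)).card))
      (∑ T ∈ S, k ^ T.height.toNat) := by
  have h1 : ∀ m : ℕ, k ^ (s + m + 1) *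
      (((S.filter fun T : PlaneTree => T.height ≤ ((s + (m + 1) : ℕ) : ℕ∞)).card : ℝ) -
        (S.filter fun T : PlaneTree => T.height ≤ ((s + m : ℕ) : ℕ∞)).card) =
      ∑ T ∈ S, if m = T.height.toNat - (s + 1) then k ^ T.height.toNat else 0 := by
    intro m
    rw [← Finset.sum_boole, ← Finset.sum_boole, ← Finset.sum_sub_distrib, Finset.mul_sum]
    refine Finset.sum_congr rfl fun T hT => ?_
    obtain ⟨h2, h3⟩ := hS T hT
    have hh := ENat.natCast_toNat h3
    set h := T.height.toNat
    have hle : ∀ n : ℕ, T.height ≤ (n : ℕ∞) ↔ h ≤ n := fun n => by rw [← hh, Nat.cast_le]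
    rw [← hh, Nat.cast_le] at h2
    simp only [hle]
    by_cases e : m = h - (s + 1)
    · rw [if_pos (by omega), if_neg (by omega), if_pos e, sub_zero, mul_one]
      congr 1
      omega
    · rw [if_neg e]
      by_cases e' : h ≤ s + m
      · rw [if_pos (by omega), if_pos e', sub_self, mul_zero]
      · rw [if_neg (by omega), if_neg e', sub_self, mul_zero]
  simp_rw [h1]
  exact hasSum_sum fun T _ => hasSum_ite_eq _ _

theorem height_ne_top_of_size_eq {T : PlaneTree} {N : ℕ} (h : T.size = N) : T.height ≠ ⊤ :=
  ne_top_of_le_ne_top (h ▸ ENat.natCast_ne_top N) T.height_le_size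

theorem coreSize_eq_of_mem_cylinder {T T₀ : PlaneTree} {s : ℕ} (h : T ∈ cylinder T₀ (s + 1)) :
    T.coreSize s = T₀.coreSize s := by
  rw [coreSize, coreSize]
  congr 1
  ext v
  simp only [Set.mem_ofPred_eq]
  constructor
  · rintro ⟨h1, h2, h3⟩
    exact ⟨(mem_iff_of_rootBall_eq h (by omega)).1 h1, h2, h3⟩
  · rintro ⟨h1, h2, h3⟩
    exact ⟨(mem_iff_of_rootBall_eq h (by omega)).2 h1, h2, h3⟩

theorem coreSize_le_size (T : PlaneTree) (s : ℕ) : (T.coreSize s : ℕ∞) ≤ T.size := by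
  rw [coreSize, Set.Finite.cast_ncard_eq (T.finite_core s), size_eq_encard_verts]
  exact Set.encard_le_encard fun v hv => ⟨hv.1, hv.2.1⟩

/-- The total weight of the trees of size `N` with the same ball of radius `r` as `T₀`. -/
noncomputable def cylinderWeight (k : ℝ) (T₀ : PlaneTree) (r N : ℕ) : ℝ :=
  open Classical in ∑ T ∈ (treesOfSize N).filter (· ∈ cylinder T₀ r), k ^ T.height.toNat

theorem coeff_rescale_pow (g : ℝ) (m K n : ℕ) :
    coeff n ((rescale g (heightSeries m)) ^ K) = g ^ n * coeff n (heightSeries m ^ K) := by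
  rw [← map_pow, coeff_rescale]

/-- Grafting turns the trees in the cylinder into `(j + 1)`-tuples of total size `M`. The factor `k
^ s` accounts for the levels below the grafted trees, and `g ^ M` for the rescaling of the variable.
-/
theorem cylinderWeight_mul {k : ℝ} (T₀ : PlaneTree) (s M : ℕ) {j : ℕ}
    (hK : (T₀.level (s + 1)).encard = (j + 1 : ℕ)) :
    cylinderWeight k T₀ (s + 1) (T₀.coreSize s + M) * criticalPoint k ^ M =
      k ^ s * coeff M (tiltedSeries k (j + 1)) := by
  classical
  have hne : (T₀.level (s + 1)).Nonempty := by
    rw [← Set.encard_ne_zero, hK]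
    simp
  have h1 := hasSum_pow_height k s ((treesOfSize (T₀.coreSize s + M)).filter
    (· ∈ cylinder T₀ (s + 1))) (by
      intro T hT
      obtain ⟨h1, h2⟩ := Finset.mem_filter.1 hT
      refine ⟨?_, height_ne_top_of_size_eq (mem_treesOfSize.1 h1)⟩
      refine le_iSup₂_of_le (s + 1) ?_ le_rfl
      rwa [level_eq_of_rootBall_eq h2])
  simp only [Finset.filter_filter] at h1
  simp only [card_cylinder_height_le T₀ s _ _ hK, coeff_X_pow_mul', if_pos (Nat.le_add_right _ _),
    Nat.add_sub_cancel_left] at h1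
  have h2 := ((PowerSeries.WithPiTopology.hasSum_iff_hasSum_coeff ℝ).1
    (hasSum_tiltedSeries (k := k) (j + 1)) M).mul_left (k ^ s)
  have h3 := h1.mul_right (criticalPoint k ^ M)
  refine h3.unique (h2.congr_fun ?_)
  intro m
  rw [coeff_C_mul, map_sub, scaledHeightSeries, scaledHeightSeries, coeff_rescale_pow,
    coeff_rescale_pow]
  ring

theorem partitionFunction_eq {μ k : ℝ} (hk : k = Real.exp (-μ)) (N : ℕ) :
    partitionFunction μ N = ∑ T ∈ treesOfSize N, k ^ T.height.toNat := by
  classical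
  have h1 := hasSum_pow_height k 0 (treesOfSize N) (by
    intro T hT
    refine ⟨?_, height_ne_top_of_size_eq (mem_treesOfSize.1 hT)⟩
    simpa using T.one_le_height)
  rw [← h1.tsum_eq, partitionFunction]
  refine tsum_congr fun m => ?_
  simp only [zero_add]
  rw [countTrees_eq_card, countTrees_eq_card, hk, ← Real.exp_nat_mul]
  congr 2
  push_cast
  ring

theorem partitionFunction_mul {μ k : ℝ} (hk : k = Real.exp (-μ)) (N : ℕ) :
    partitionFunction μ N * criticalPoint k ^ N = coeff N (tiltedSeries k 1) := by
  classical
  rw [partitionFunction, ← tsum_mul_right, tiltedSeries, coeff_mk]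
  refine tsum_congr fun m => ?_
  rw [map_sub, pow_one, pow_one, scaledHeightSeries, scaledHeightSeries, coeff_rescale,
    coeff_rescale, coeff_heightSeries, coeff_heightSeries, hk, ← Real.exp_nat_mul,
    show ((m + 1 : ℕ) : ℝ) * -μ = -μ * (m + 1) by push_cast; ring]
  ring

theorem partitionFunction_pos (μ : ℝ) (N : ℕ) : 0 < partitionFunction μ (N + 1) := by
  rw [partitionFunction_eq rfl]
  exact Finset.sum_pos (fun T _ => pow_pos (Real.exp_pos _) _) (treesOfSize_nonempty N)

end PlaneTree

namespace PlaneTree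

/-! ### Topology of the space of trees -/

theorem mem_cylinder_self (T : PlaneTree) (r : ℕ) : T ∈ cylinder T r := rfl

theorem cylinder_eq_of_mem {T T₀ : PlaneTree} {r : ℕ} (h : T ∈ cylinder T₀ r) :
    cylinder T r = cylinder T₀ r := by
  ext S
  simp only [cylinder, Set.mem_ofPred_eq] at h ⊢
  rw [h]

theorem cylinder_anti {T : PlaneTree} {r s : ℕ} (h : r ≤ s) : cylinder T s ⊆ cylinder T r :=
  fun _ hS => rootBall_mono hS h

theorem isClopen_cylinder (T₀ : PlaneTree) (s : ℕ) : IsClopen (cylinder T₀ (s + 1)) := by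
  refine ⟨?_, Metric.isOpen_iff.2 fun T hT => ?_⟩
  · rw [← closedBall_eq_cylinder T₀ (Nat.le_add_left 1 s)]
    exact Metric.isClosed_closedBall
  · refine ⟨1 / ((s + 1 : ℕ) : ℝ), by positivity, ?_⟩
    rw [← cylinder_eq_of_mem hT, ← closedBall_eq_cylinder T (Nat.le_add_left 1 s)]
    exact Metric.ball_subset_closedBall

theorem exists_cylinder_subset {U : Set PlaneTree} (hU : IsOpen U) {T : PlaneTree} (hT : T ∈ U) :
    ∃ s : ℕ, cylinder T (s + 1) ⊆ U := by
  obtain ⟨ε, hε, h⟩ := Metric.isOpen_iff.1 hU T hT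
  obtain ⟨s, hs⟩ := exists_nat_one_div_lt hε
  refine ⟨s, ?_⟩
  rw [← closedBall_eq_cylinder T (Nat.le_add_left 1 s)]
  refine subset_trans (Metric.closedBall_subset_ball ?_) h
  push_cast
  exact hs

theorem mem_cylinder_trunc (T : PlaneTree) (s : ℕ) : T ∈ cylinder (T.trunc s) (s + 1) :=
  (T.rootBall_trunc s).symm

theorem cylinder_trunc (T : PlaneTree) (s : ℕ) :
    cylinder (T.trunc s) (s + 1) = cylinder T (s + 1) :=
  (cylinder_eq_of_mem (T.mem_cylinder_trunc s)).symm

theorem trunc_eq_iff (T T₀ : PlaneTree) (s : ℕ) :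
    T.trunc s = T₀.trunc s ↔ T ∈ cylinder T₀ (s + 1) := by
  constructor
  · intro h
    exact congrArg PlaneTree.verts h
  · intro h
    exact PlaneTree.ext h

theorem trunc_trunc (T : PlaneTree) (s : ℕ) : (T.trunc s).trunc s = T.trunc s :=
  (trunc_eq_iff _ _ _).2 (T.rootBall_trunc s)

theorem countable_setOf_size_ne_top : {T : PlaneTree | T.size ≠ ⊤}.Countable := by
  refine (Set.countable_iUnion fun N : ℕ => (finite_setOf_size_eq N).countable).mono ?_
  intro T hT
  exact Set.mem_iUnion.2 ⟨T.size.toNat, (ENat.natCast_toNat hT).symm⟩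

/-- The collection of all cylinders. -/
def cylinders : Set (Set PlaneTree) := {A | ∃ (T : PlaneTree) (s : ℕ), A = cylinder T (s + 1)}

theorem countable_cylinders : cylinders.Countable := by
  have h : cylinders ⊆ ⋃ s : ℕ, (fun T => cylinder T (s + 1)) '' {T : PlaneTree | T.size ≠ ⊤} := by
    rintro _ ⟨T, s, rfl⟩
    exact Set.mem_iUnion.2 ⟨s, T.trunc s, T.size_trunc_ne_top s, cylinder_trunc T s⟩
  exact (Set.countable_iUnion fun s => countable_setOf_size_ne_top.image _).mono h

theorem isPiSystem_cylinders : IsPiSystem cylinders := by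
  rintro _ ⟨T₁, s₁, rfl⟩ _ ⟨T₂, s₂, rfl⟩ ⟨T, h1, h2⟩
  rw [← cylinder_eq_of_mem h1, ← cylinder_eq_of_mem h2]
  rcases le_total s₁ s₂ with h | h
  · exact ⟨T, s₂, Set.inter_eq_right.2 (cylinder_anti (by omega))⟩
  · exact ⟨T, s₁, Set.inter_eq_left.2 (cylinder_anti (by omega))⟩

theorem isTopologicalBasis_cylinders : TopologicalSpace.IsTopologicalBasis cylinders := by
  refine TopologicalSpace.isTopologicalBasis_of_isOpen_of_nhds ?_ ?_
  · rintro _ ⟨T, s, rfl⟩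
    exact (isClopen_cylinder T s).2
  · intro T U hT hU
    obtain ⟨s, hs⟩ := exists_cylinder_subset hU hT
    exact ⟨_, ⟨T, s, rfl⟩, T.mem_cylinder_self _, hs⟩

theorem borel_eq_generateFrom_cylinders :
    (inferInstance : MeasurableSpace PlaneTree) = MeasurableSpace.generateFrom cylinders := by
  have := isTopologicalBasis_cylinders.secondCountableTopology countable_cylinders
  exact isTopologicalBasis_cylinders.borel_eq_generateFrom

theorem measurableSet_cylinder (T : PlaneTree) (s : ℕ) : MeasurableSet (cylinder T (s + 1)) :=
  (isClopen_cylinder T s).2.measurableSet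

/-- Two probability measures that agree on all cylinders are equal. -/
theorem probabilityMeasure_ext {ν ν' : ProbabilityMeasure PlaneTree}
    (h : ∀ T s, (ν : Measure PlaneTree) (cylinder T (s + 1)) =
      (ν' : Measure PlaneTree) (cylinder T (s + 1))) : ν = ν' := by
  have : (ν : Measure PlaneTree) = ν' := by
    refine ext_of_generate_finite cylinders borel_eq_generateFrom_cylinders
      isPiSystem_cylinders ?_ (by simp)
    rintro _ ⟨T, s, rfl⟩
    exact h T s
  exact Subtype.ext this

/-- A set of trees is compact if, for each radius, it consists of all trees with a ball from a given
finite set. -/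
theorem isCompact_setOf_trunc_mem {F : ℕ → Set PlaneTree} (hF : ∀ s, (F s).Finite) :
    IsCompact {T : PlaneTree | ∀ s, T.trunc s ∈ F s} := by
  rw [isCompact_iff_ultrafilter_le_nhds]
  intro U hU
  rw [le_principal_iff] at hU
  -- For each radius the ultrafilter selects one of the finitely many balls; these balls are
  -- consistent and assemble to the limit tree `T₀`.
  have hb : ∀ s, ∃ b ∈ F s, ∀ᶠ T in (U : Filter PlaneTree), T.trunc s = b := by
    intro s
    have h1 : (⋃ b ∈ F s, {T : PlaneTree | T.trunc s = b}) ∈ U := by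
      refine mem_of_superset hU fun T hT => ?_
      simp only [Set.mem_iUnion]
      exact ⟨T.trunc s, hT s, rfl⟩
    exact (Ultrafilter.finite_biUnion_mem_iff (hF s)).1 h1
  choose b hbF hbU using hb
  have hmem : ∀ s (v : List ℕ), v.length ≤ s + 1 →
      ((∀ᶠ T in (U : Filter PlaneTree), v ∈ T.verts) ↔ v ∈ (b s).verts) := by
    intro s v hv
    have h1 : ∀ᶠ T in (U : Filter PlaneTree), (v ∈ T.verts ↔ v ∈ (b s).verts) := by
      filter_upwards [hbU s] with T hT
      rw [← hT]
      simp [trunc, rootBall, hv]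
    rw [eventually_congr h1, eventually_const]
  let T₀ : PlaneTree :=
    { verts := {v | ∀ᶠ T in (U : Filter PlaneTree), v ∈ T.verts}
      root_mem := Eventually.of_forall fun T => T.root_mem
      parent_mem := fun v i h => h.mono fun T hT => T.parent_mem v i hT
      offspring := fun v hv => by
        obtain ⟨n, hn⟩ := (b v.length).offspring v ((hmem _ v (by omega)).1 hv)
        refine ⟨n, fun i => ?_⟩
        rw [← hn]
        exact hmem v.length (v ++ [i]) (by simp)
      root_edge := fun i => by
        have : ∀ T : PlaneTree, [i] ∈ T.verts ↔ i = 0 := fun T => T.root_edge i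
        simp only [Set.mem_ofPred_eq, this, eventually_const] }
  have htr : ∀ s, T₀.trunc s = b s := by
    intro s
    obtain ⟨T, hT⟩ := (hbU s).exists
    rw [← hT, trunc_eq_iff]
    refine rootBall_eq_iff.2 fun v hv => ?_
    rw [show v ∈ T₀.verts ↔ v ∈ (b s).verts from hmem s v hv, ← hT]
    simp [trunc, rootBall, hv]
  refine ⟨T₀, fun s => htr s ▸ hbF s, ?_⟩
  intro V hV
  obtain ⟨W, hWV, hW, hTW⟩ := mem_nhds_iff.1 hV
  obtain ⟨s, hs⟩ := exists_cylinder_subset hW hTW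
  filter_upwards [hbU s] with T hT
  refine hWV (hs ?_)
  rw [← trunc_eq_iff, hT, htr]

/-! ### The series over finite trees -/

-- Summation over the fibres of the size map reduces this to the value at one of the rescaled tree
-- series.
open PowerSeries in
theorem hasSum_pow_size {k : ℝ} (hk : 1 < k) :
    HasSum (fun T : {T : PlaneTree // T.size ≠ ⊤} => criticalPoint k ^ T.1.size.toNat)
      (1 / (1 + k)) := by
  set g := criticalPoint k with hg
  have hg0 : 0 < g := criticalPoint_pos hk
  set f : {T : PlaneTree // T.size ≠ ⊤} → ℕ := fun T => T.1.size.toNat with hf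
  rw [← (Equiv.sigmaFiberEquiv f).hasSum_iff]
  have hfib : ∀ N, HasSum (fun x : {x // f x = N} =>
      ((fun T : {T : PlaneTree // T.size ≠ ⊤} => g ^ T.1.size.toNat) ∘ Equiv.sigmaFiberEquiv f)
        ⟨N, x⟩) (coeff N (scaledTreeSeries k)) := by
    intro N
    let e : {x // f x = N} ≃ treesOfSize N :=
      { toFun := fun x => ⟨x.1.1, mem_treesOfSize.2 (by
          rw [← ENat.natCast_toNat x.1.2]
          exact congrArg Nat.cast x.2)⟩
        invFun := fun T => ⟨⟨T.1, by
          rw [mem_treesOfSize.1 T.2]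
          exact ENat.natCast_ne_top N⟩, by simp [hf, mem_treesOfSize.1 T.2]⟩
        left_inv := fun x => rfl
        right_inv := fun T => rfl }
    rw [← e.symm.hasSum_iff]
    have h1 : ∀ T : treesOfSize N, (((fun x : {x // f x = N} =>
        ((fun T : {T : PlaneTree // T.size ≠ ⊤} => g ^ T.1.size.toNat) ∘
          Equiv.sigmaFiberEquiv f) ⟨N, x⟩)) ∘ e.symm) T = g ^ N := by
      intro T
      have := mem_treesOfSize.1 T.2
      simp [e, Equiv.sigmaFiberEquiv, this]
    have h2 := hasSum_fintype fun _ : treesOfSize N => g ^ N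
    rw [Finset.sum_const, Finset.card_univ, Fintype.card_coe, ← countTrees_self] at h2
    rw [scaledTreeSeries, coeff_rescale, coeff_treeSeries, ← hg, mul_comm, ← nsmul_eq_mul]
    exact h2.congr_fun h1
  have hs := (absSummable_scaledTreeSeries hk).summable
  have hsum : Summable ((fun T : {T : PlaneTree // T.size ≠ ⊤} => g ^ T.1.size.toNat) ∘
      Equiv.sigmaFiberEquiv f) := by
    refine (summable_sigma_of_nonneg fun x => by simp only [Function.comp]; positivity).2
      ⟨fun N => (hfib N).summable, ?_⟩
    simpa only [(hfib _).tsum_eq] using hs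
  have h3 := hsum.hasSum.sigma hfib
  rw [← evalOne_scaledTreeSeries hk, evalOne, h3.tsum_eq]
  exact hsum.hasSum

theorem genFun_criticalPoint {k : ℝ} (hk : 1 < k) : genFun (criticalPoint k) = 1 / (1 + k) :=
  (hasSum_pow_size hk).tsum_eq

end PlaneTree

namespace PlaneTree

open PowerSeries

/-! ### The measures on trees of a fixed size -/

open Classical in
theorem finiteSizeMeasure_apply {μ k : ℝ} (hk : k = Real.exp (-μ)) (N : ℕ) {A : Set PlaneTree}
    (hA : MeasurableSet A) : finiteSizeMeasure μ (N + 1) A =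
      ENNReal.ofReal ((∑ T ∈ (treesOfSize (N + 1)).filter (· ∈ A), k ^ T.height.toNat) /
        partitionFunction μ (N + 1)) := by
  have : Fintype {T : PlaneTree // T.size = (N + 1 : ℕ)} := (finite_setOf_size_eq (N + 1)).fintype
  have hZ := partitionFunction_pos μ N
  have hk0 : 0 < k := hk ▸ Real.exp_pos _
  rw [finiteSizeMeasure, Measure.sum_apply _ hA, tsum_fintype, Finset.sum_div,
    ENNReal.ofReal_sum_of_nonneg (fun T _ => by positivity), Finset.sum_filter,
    Finset.sum_subtype (p := fun T : PlaneTree => T.size = (N + 1 : ℕ)) (treesOfSize (N + 1))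
      fun T => mem_treesOfSize]
  refine Finset.sum_congr rfl fun T _ => ?_
  rw [Measure.smul_apply, Measure.dirac_apply' _ hA, smul_eq_mul, Set.indicator_apply]
  have : Real.exp (-μ * (T.1.height.toNat : ℝ)) = k ^ T.1.height.toNat := by
    rw [hk, ← Real.exp_nat_mul, mul_comm]
  rw [this]
  split_ifs <;> simp

theorem isProbabilityMeasure_finiteSizeMeasure (μ : ℝ) (N : ℕ) :
    IsProbabilityMeasure (finiteSizeMeasure μ (N + 1)) := by
  classical
  refine ⟨?_⟩
  rw [finiteSizeMeasure_apply rfl N MeasurableSet.univ]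
  simp only [Set.mem_univ, Finset.filter_true]
  rw [← partitionFunction_eq rfl, div_self (partitionFunction_pos μ N).ne', ENNReal.ofReal_one]

theorem finiteSizeMeasure_real_cylinder {μ k : ℝ} (hk : k = Real.exp (-μ)) (N : ℕ)
    (T₀ : PlaneTree) (s : ℕ) : (finiteSizeMeasure μ (N + 1)).real (cylinder T₀ (s + 1)) =
      cylinderWeight k T₀ (s + 1) (N + 1) / partitionFunction μ (N + 1) := by
  classical
  have hk0 : 0 < k := hk ▸ Real.exp_pos _
  rw [Measure.real, finiteSizeMeasure_apply hk N (measurableSet_cylinder T₀ s),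
    ENNReal.toReal_ofReal]
  · rfl
  · have := (partitionFunction_pos μ N).le
    exact div_nonneg (Finset.sum_nonneg fun T _ => by positivity) this

/-- The asymptotic probability of the cylinder of `T₀`. -/
noncomputable def limitWeight (k : ℝ) (T₀ : PlaneTree) (s : ℕ) : ℝ :=
  k ^ s * criticalPoint k ^ T₀.coreSize s *
    ((T₀.level (s + 1)).ncard * (1 / (1 + k)) ^ ((T₀.level (s + 1)).ncard - 1))

theorem one_lt_of_eq_exp {μ k : ℝ} (hμ : μ < 0) (hk : k = Real.exp (-μ)) : 1 < k := by
  rw [hk, Real.one_lt_exp_iff]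
  linarith

theorem encard_level_eq_ncard (T : PlaneTree) (r : ℕ) :
    (T.level r).encard = ((T.level r).ncard : ℕ) :=
  (Set.Finite.cast_ncard_eq (T.finite_level r)).symm

theorem exists_ncard_eq_succ {T : PlaneTree} {r : ℕ} (h : (T.level r).Nonempty) :
    ∃ j, (T.level r).ncard = j + 1 := by
  obtain ⟨v, hv⟩ := h
  exact Nat.exists_eq_succ_of_ne_zero (Set.ncard_ne_zero_of_mem hv (T.finite_level r))

theorem tendsto_coeff_tiltedSeries_one {k : ℝ} (hk : 1 < k) :
    Tendsto (fun N : ℕ => coeff (N + 1) (tiltedSeries k 1)) atTop (𝓝 (tiltedLimit k)) := by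
  have := tendsto_coeff_tiltedSeries hk 0
  simp only [zero_add, Nat.cast_one, pow_zero, mul_one, one_mul] at this
  exact this.comp (tendsto_add_atTop_nat 1)

theorem coeff_tiltedSeries_one_pos {μ k : ℝ} (hμ : μ < 0) (hk : k = Real.exp (-μ)) (N : ℕ) :
    0 < coeff (N + 1) (tiltedSeries k 1) := by
  rw [← partitionFunction_mul hk]
  exact mul_pos (partitionFunction_pos μ N)
    (pow_pos (criticalPoint_pos (one_lt_of_eq_exp hμ hk)) _)

theorem real_cylinder_of_le {μ k : ℝ} (hμ : μ < 0) (hk : k = Real.exp (-μ)) {T₀ : PlaneTree}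
    {s j : ℕ} (hj : (T₀.level (s + 1)).ncard = j + 1) {N : ℕ} (hN : T₀.coreSize s ≤ N + 1) :
    (finiteSizeMeasure μ (N + 1)).real (cylinder T₀ (s + 1)) =
      k ^ s * criticalPoint k ^ T₀.coreSize s *
        (coeff (N + 1 - T₀.coreSize s) (tiltedSeries k (j + 1)) *
          (coeff (N + 1) (tiltedSeries k 1))⁻¹) := by
  have hk1 := one_lt_of_eq_exp hμ hk
  have hg := criticalPoint_pos hk1
  obtain ⟨M, hM⟩ := Nat.exists_eq_add_of_le hN
  have hK : (T₀.level (s + 1)).encard = (j + 1 : ℕ) := by rw [encard_level_eq_ncard, hj]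
  have h1 := cylinderWeight_mul (k := k) T₀ s M hK
  have h2 := partitionFunction_mul hk (N + 1)
  have hZ := partitionFunction_pos μ N
  rw [finiteSizeMeasure_real_cylinder hk, ← h2, hM, Nat.add_sub_cancel_left, ← hM]
  have h3 : cylinderWeight k T₀ (s + 1) (N + 1) =
      k ^ s * coeff M (tiltedSeries k (j + 1)) / criticalPoint k ^ M := by
    rw [eq_div_iff (pow_pos hg _).ne', ← h1, hM]
  have h4 : criticalPoint k ^ (N + 1) = criticalPoint k ^ T₀.coreSize s * criticalPoint k ^ M := by
    rw [hM, pow_add]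
  rw [h3, h4]
  have e1 := (pow_pos hg M).ne'
  have e2 := (pow_pos hg (T₀.coreSize s)).ne'
  have e3 := hZ.ne'
  field_simp

theorem real_cylinder_of_lt {μ k : ℝ} (hk : k = Real.exp (-μ)) {T₀ : PlaneTree}
    {s : ℕ} {N : ℕ} (hN : N + 1 < T₀.coreSize s) :
    (finiteSizeMeasure μ (N + 1)).real (cylinder T₀ (s + 1)) = 0 := by
  classical
  rw [finiteSizeMeasure_real_cylinder hk, cylinderWeight, Finset.filter_eq_empty_iff.2]
  · simp
  · intro T hT h
    have h1 := T.coreSize_le_size s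
    rw [coreSize_eq_of_mem_cylinder h, mem_treesOfSize.1 hT] at h1
    have : T₀.coreSize s ≤ N + 1 := by exact_mod_cast h1
    omega

theorem size_ne_top_of_level_empty {T : PlaneTree} {r : ℕ} (h : T.level r = ∅) : T.size ≠ ⊤ := by
  refine size_ne_top_of_finite ((T.finite_rootBall r).subset fun v hv => ⟨hv, ?_⟩)
  by_contra hlt
  have : v.take r ∈ T.level r :=
    ⟨T.mem_of_append _ (v.drop r) (by simpa using hv), by simp; omega⟩
  simp [h] at this

theorem height_le_of_level_empty {T : PlaneTree} {s : ℕ} (h : T.level (s + 1) = ∅) :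
    T.height ≤ s := by
  refine (height_le_iff T s).2 fun v hv => ?_
  by_contra hlt
  have : v.take (s + 1) ∈ T.level (s + 1) :=
    ⟨T.mem_of_append _ (v.drop (s + 1)) (by simpa using hv), by simp; omega⟩
  simp [h] at this

theorem cylinder_eq_singleton {T : PlaneTree} {r : ℕ} (h : T.level r = ∅) :
    cylinder T r = {T} := by
  ext S
  constructor
  · intro hS
    exact (eq_of_rootBall_eq_of_level_empty (Eq.symm hS) h).symm
  · rintro rfl
    rfl

open Classical in
theorem real_cylinder_of_level_empty {μ k : ℝ} (hk : k = Real.exp (-μ)) {T₀ : PlaneTree} {s : ℕ}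
    (h : T₀.level (s + 1) = ∅) (N : ℕ) :
    (finiteSizeMeasure μ (N + 1)).real (cylinder T₀ (s + 1)) =
      if T₀.size = (N + 1 : ℕ) then k ^ T₀.height.toNat / partitionFunction μ (N + 1) else 0 := by
  rw [finiteSizeMeasure_real_cylinder hk, cylinderWeight, cylinder_eq_singleton h,
    Finset.sum_filter]
  simp only [Set.mem_singleton_iff, Finset.sum_ite_eq', mem_treesOfSize]
  split_ifs
  · rfl
  · rw [zero_div]

/-- Convergence of the probabilities of cylinders. -/
theorem tendsto_real_cylinder {μ k : ℝ} (hμ : μ < 0) (hk : k = Real.exp (-μ)) (T₀ : PlaneTree)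
    (s : ℕ) : Tendsto (fun N : ℕ => (finiteSizeMeasure μ (N + 1)).real (cylinder T₀ (s + 1))) atTop
      (𝓝 (limitWeight k T₀ s)) := by
  have hk1 := one_lt_of_eq_exp hμ hk
  rcases (T₀.level (s + 1)).eq_empty_or_nonempty with h | h
  · have hsize := size_ne_top_of_level_empty h
    -- The cylinder is a single finite tree, which eventually has the wrong size. The factor `K = 0`
    -- makes the weight vanish despite the truncated exponent `K - 1`.
    rw [limitWeight, h]
    simp only [Set.ncard_empty, Nat.cast_zero, zero_mul, mul_zero]
    refine tendsto_const_nhds.congr' ?_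
    filter_upwards [eventually_gt_atTop T₀.size.toNat] with N hN
    rw [real_cylinder_of_level_empty hk h, if_neg]
    intro h1
    rw [h1, ENat.toNat_natCast] at hN
    omega
  · obtain ⟨j, hj⟩ := exists_ncard_eq_succ h
    have hβ := tiltedLimit_pos hk1
    have h1 : Tendsto (fun N : ℕ => coeff (N + 1 - T₀.coreSize s) (tiltedSeries k (j + 1))) atTop
        (𝓝 ((j + 1 : ℕ) * (1 / (1 + k)) ^ j * tiltedLimit k)) :=
      (tendsto_coeff_tiltedSeries hk1 j).comp
        ((tendsto_sub_atTop_nat _).comp (tendsto_add_atTop_nat 1))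
    have h2 := tendsto_coeff_tiltedSeries_one hk1
    have h3 := (h1.mul (h2.inv₀ hβ.ne')).const_mul (k ^ s * criticalPoint k ^ T₀.coreSize s)
    have h4 : limitWeight k T₀ s = k ^ s * criticalPoint k ^ T₀.coreSize s *
        ((j + 1 : ℕ) * (1 / (1 + k)) ^ j * tiltedLimit k * (tiltedLimit k)⁻¹) := by
      rw [limitWeight, hj, mul_inv_cancel_right₀ hβ.ne', Nat.add_sub_cancel]
    rw [h4]
    refine h3.congr' ?_
    filter_upwards [eventually_ge_atTop (T₀.coreSize s)] with N hN
    rw [real_cylinder_of_le hμ hk hj (by omega)]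

/-- A bound on the probabilities of cylinders that is uniform in the size. -/
theorem exists_real_cylinder_le {μ k : ℝ} (hμ : μ < 0) (hk : k = Real.exp (-μ)) :
    ∃ M : ℝ, 0 ≤ M ∧ ∀ (T₀ : PlaneTree) (s N : ℕ),
      (finiteSizeMeasure μ (N + 1)).real (cylinder T₀ (s + 1)) ≤
        M * (limitWeight k T₀ s + k ^ s * criticalPoint k ^ T₀.size.toNat) := by
  have hk1 := one_lt_of_eq_exp hμ hk
  have hg := criticalPoint_pos hk1
  have hβ := tiltedLimit_pos hk1
  have h2 := tendsto_coeff_tiltedSeries_one hk1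
  obtain ⟨M₁, hM₁⟩ := (h2.inv₀ hβ.ne').bddAbove_range
  have hM₁ : ∀ N, (coeff (N + 1) (tiltedSeries k 1))⁻¹ ≤ M₁ := fun N => hM₁ ⟨N, rfl⟩
  have hpos := coeff_tiltedSeries_one_pos hμ hk
  have hM₁0 : 0 ≤ M₁ := (inv_nonneg.2 (hpos 0).le).trans (hM₁ 0)
  obtain ⟨M₂, hM₂0, hM₂⟩ := exists_coeff_tiltedSeries_le hk1
  have hlw : ∀ T₀ s, 0 ≤ limitWeight k T₀ s := fun T₀ s => by
    rw [limitWeight]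
    positivity
  refine ⟨M₁ * M₂ + M₁, by positivity, fun T₀ s N => ?_⟩
  have hw := hlw T₀ s
  have hs0 : 0 ≤ k ^ s * criticalPoint k ^ T₀.size.toNat := by positivity
  rcases (T₀.level (s + 1)).eq_empty_or_nonempty with h | h
  -- For trees too short to reach the level, the limit weight is 0 but the mass at one particular
  -- size is not. The extra term `k^s g^|T₀|` covers this case.
  · rw [real_cylinder_of_level_empty hk h]
    split_ifs with h1
    · have h3 : T₀.height.toNat ≤ s := ENat.toNat_le_of_le_natCast (height_le_of_level_empty h)
      have h4 : k ^ T₀.height.toNat / partitionFunction μ (N + 1) =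
          k ^ T₀.height.toNat * criticalPoint k ^ (N + 1) *
            (coeff (N + 1) (tiltedSeries k 1))⁻¹ := by
        rw [← partitionFunction_mul hk]
        have e1 := (pow_pos hg (N + 1)).ne'
        have e2 := (partitionFunction_pos μ N).ne'
        field_simp
      rw [h4, h1, ENat.toNat_natCast]
      rw [h1, ENat.toNat_natCast] at hs0
      calc k ^ T₀.height.toNat * criticalPoint k ^ (N + 1) * (coeff (N + 1) (tiltedSeries k 1))⁻¹
          ≤ k ^ s * criticalPoint k ^ (N + 1) * M₁ := by
            refine mul_le_mul ?_ (hM₁ N) (inv_nonneg.2 (hpos N).le) hs0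
            exact mul_le_mul_of_nonneg_right (pow_le_pow_right₀ hk1.le h3) (by positivity)
        _ ≤ (M₁ * M₂ + M₁) * (limitWeight k T₀ s + k ^ s * criticalPoint k ^ (N + 1)) := by
            have e1 : 0 ≤ (M₁ * M₂ + M₁) * limitWeight k T₀ s := by positivity
            have e2 : 0 ≤ (M₁ * M₂) * (k ^ s * criticalPoint k ^ (N + 1)) := by positivity
            linarith
    · positivity
  · obtain ⟨j, hj⟩ := exists_ncard_eq_succ h
    rcases le_or_gt (T₀.coreSize s) (N + 1) with h1 | h1
    · rw [real_cylinder_of_le hμ hk hj h1]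
      have e3 : k ^ s * criticalPoint k ^ T₀.coreSize s *
          (coeff (N + 1 - T₀.coreSize s) (tiltedSeries k (j + 1)) *
            (coeff (N + 1) (tiltedSeries k 1))⁻¹) ≤ M₁ * M₂ * limitWeight k T₀ s := by
        calc k ^ s * criticalPoint k ^ T₀.coreSize s *
              (coeff (N + 1 - T₀.coreSize s) (tiltedSeries k (j + 1)) *
                (coeff (N + 1) (tiltedSeries k 1))⁻¹)
            ≤ k ^ s * criticalPoint k ^ T₀.coreSize s *
              (((j + 1 : ℕ) * (1 / (1 + k)) ^ j * M₂) * M₁) := by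
              refine mul_le_mul_of_nonneg_left ?_ (by positivity)
              exact mul_le_mul (hM₂ j _) (hM₁ N) (inv_nonneg.2 (hpos N).le) (by positivity)
          _ = M₁ * M₂ * limitWeight k T₀ s := by
              rw [limitWeight, hj, Nat.add_sub_cancel]
              ring
      have e1 : 0 ≤ M₁ * limitWeight k T₀ s := by positivity
      have e2 : 0 ≤ (M₁ * M₂ + M₁) * (k ^ s * criticalPoint k ^ T₀.size.toNat) := by positivity
      linarith
    · rw [real_cylinder_of_lt hk h1]
      positivity

end PlaneTree

namespace PlaneTree

/-! ### Tightness and convergence -/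

/-- The trees of height at most `s + 1`; they index the cylinders of radius `s + 1`. -/
abbrev TruncatedTree (s : ℕ) : Type := {T : PlaneTree // T.trunc s = T}

theorem size_ne_top_of_trunc_eq {T : PlaneTree} {s : ℕ} (h : T.trunc s = T) : T.size ≠ ⊤ :=
  h ▸ T.size_trunc_ne_top s

instance (s : ℕ) : Countable (TruncatedTree s) :=
  (countable_setOf_size_ne_top.mono
    fun _ (h : _ = _) => size_ne_top_of_trunc_eq h : {T : PlaneTree | T.trunc s = T}.Countable)

theorem pairwise_disjoint_cylinder (s : ℕ) :
    Pairwise (Function.onFun Disjoint fun T : TruncatedTree s => cylinder T.1 (s + 1)) := by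
  intro T T' hne
  refine Set.disjoint_left.2 fun S h h' => hne (Subtype.ext ?_)
  rw [← T.2, ← T'.2, ← (trunc_eq_iff S T.1 s).2 h, (trunc_eq_iff S T'.1 s).2 h']

theorem limitWeight_nonneg {k : ℝ} (hk : 1 < k) (T : PlaneTree) (s : ℕ) :
    0 ≤ limitWeight k T s := by
  have := criticalPoint_pos hk
  rw [limitWeight]
  positivity

/-- Finite sums of limit weights are limits of probabilities of disjoint unions of cylinders, hence
at most 1. -/
theorem summable_limitWeight {μ k : ℝ} (hμ : μ < 0) (hk : k = Real.exp (-μ)) (s : ℕ) :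
    Summable fun T : TruncatedTree s => limitWeight k T.1 s := by
  have hk1 := one_lt_of_eq_exp hμ hk
  refine summable_of_sum_le (c := 1) (fun T => limitWeight_nonneg hk1 T.1 s) fun F => ?_
  refine le_of_tendsto (tendsto_finsetSum F fun T _ => tendsto_real_cylinder hμ hk T.1 s)
    (Eventually.of_forall fun N => ?_)
  have := isProbabilityMeasure_finiteSizeMeasure μ N
  rw [← measureReal_biUnion_finset (fun T _ T' _ h => pairwise_disjoint_cylinder s h)
    (fun T _ => measurableSet_cylinder T.1 s)]
  exact measureReal_le_one

/-- Up to a small probability, uniformly in the size, the ball of a given radius belongs to a finite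
set. -/
theorem exists_finite_trunc_notMem_le {μ k : ℝ} (hμ : μ < 0) (hk : k = Real.exp (-μ)) (s : ℕ)
    {ε : ENNReal} (hε : 0 < ε) : ∃ F : Set PlaneTree, F.Finite ∧
      ∀ N, finiteSizeMeasure μ (N + 1) {T | T.trunc s ∉ F} ≤ ε := by
  have hk1 := one_lt_of_eq_exp hμ hk
  have hg := criticalPoint_pos hk1
  obtain ⟨M, hM0, hM⟩ := exists_real_cylinder_le hμ hk
  set β : TruncatedTree s → ℝ := fun T =>
    M * (limitWeight k T.1 s + k ^ s * criticalPoint k ^ T.1.size.toNat) with hβ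
  have hβ0 : ∀ T, 0 ≤ β T := fun T => by
    have := limitWeight_nonneg hk1 T.1 s
    simp only [hβ]
    positivity
  have hβs : Summable β := by
    refine Summable.mul_left M ((summable_limitWeight hμ hk s).add (Summable.mul_left _ ?_))
    have := (hasSum_pow_size hk1).summable.comp_injective
      (i := fun T : TruncatedTree s => ⟨T.1, size_ne_top_of_trunc_eq T.2⟩)
      (fun T T' h => Subtype.ext (congrArg (fun x => x.1) h))
    exact this
  have hsum : ∑' T, ENNReal.ofReal (β T) ≠ ⊤ := by
    rw [← ENNReal.ofReal_tsum_of_nonneg hβ0 hβs]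
    exact ENNReal.ofReal_ne_top
  obtain ⟨F, hF⟩ := ((ENNReal.tendsto_tsum_compl_atTop_zero hsum).eventually
    (gt_mem_nhds hε)).exists
  refine ⟨Subtype.val '' (F : Set (TruncatedTree s)), F.finite_toSet.image _, fun N => ?_⟩
  have := isProbabilityMeasure_finiteSizeMeasure μ N
  have hsub : {T : PlaneTree | T.trunc s ∉ Subtype.val '' (F : Set (TruncatedTree s))} ⊆
      ⋃ T : {T : TruncatedTree s // T ∉ F}, cylinder T.1.1 (s + 1) := by
    intro T hT
    refine Set.mem_iUnion.2 ⟨⟨⟨T.trunc s, T.trunc_trunc s⟩, fun h => hT ?_⟩,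
      T.mem_cylinder_trunc s⟩
    exact ⟨_, h, rfl⟩
  calc finiteSizeMeasure μ (N + 1) _
      ≤ finiteSizeMeasure μ (N + 1)
          (⋃ T : {T : TruncatedTree s // T ∉ F}, cylinder T.1.1 (s + 1)) := measure_mono hsub
    _ ≤ ∑' T : {T : TruncatedTree s // T ∉ F},
          finiteSizeMeasure μ (N + 1) (cylinder T.1.1 (s + 1)) := measure_iUnion_le _
    _ ≤ ∑' T : {T : TruncatedTree s // T ∉ F}, ENNReal.ofReal (β T.1) := by
        refine ENNReal.tsum_le_tsum fun T => ?_
        rw [← ofReal_measureReal (measure_ne_top _ _)]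
        exact ENNReal.ofReal_le_ofReal (hM T.1.1 s N)
    _ ≤ ε := hF.le

/-- The measures on trees of fixed size as probability measures. -/
noncomputable def finiteSizeLaw (μ : ℝ) (N : ℕ) : ProbabilityMeasure PlaneTree :=
  ⟨finiteSizeMeasure μ (N + 1), isProbabilityMeasure_finiteSizeMeasure μ N⟩

/-- Prokhorov's theorem: the exceptional probability for radius `s + 1` is at most `δ s` with `∑ δ s
< ε`, and confining every ball to a finite set defines a compact set. -/
theorem isCompact_closure_range_finiteSizeLaw {μ : ℝ} (hμ : μ < 0) :
    IsCompact (closure (Set.range (finiteSizeLaw μ))) := by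
  refine isCompact_closure_of_isTightMeasureSet ?_
  rw [isTightMeasureSet_iff_exists_isCompact_measure_compl_le]
  intro ε hε
  obtain ⟨δ, hδ0, hδ⟩ := ENNReal.exists_pos_sum_of_countable' hε.ne' ℕ
  choose F hF hFN using fun s => exists_finite_trunc_notMem_le hμ rfl s (hδ0 s)
  refine ⟨_, isCompact_setOf_trunc_mem hF, ?_⟩
  rintro _ ⟨_, ⟨N, rfl⟩, rfl⟩
  have hc : {T : PlaneTree | ∀ s, T.trunc s ∈ F s}ᶜ = ⋃ s, {T | T.trunc s ∉ F s} := by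
    ext T
    simp
  rw [hc]
  refine (measure_iUnion_le _).trans (le_trans ?_ hδ.le)
  exact ENNReal.tsum_le_tsum fun s => hFN s N

/-- Cylinders are clopen, so their boundary is empty and weak convergence along an ultrafilter
preserves their probabilities. -/
theorem real_cylinder_of_mapClusterPt {μ k : ℝ} (hμ : μ < 0) (hk : k = Real.exp (-μ))
    {ν : ProbabilityMeasure PlaneTree} (hν : MapClusterPt ν atTop (finiteSizeLaw μ))
    (T : PlaneTree) (s : ℕ) :
    (ν : Measure PlaneTree).real (cylinder T (s + 1)) = limitWeight k T s := by
  obtain ⟨U, hU, hUν⟩ := mapClusterPt_iff_ultrafilter.1 hν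
  have h1 := ProbabilityMeasure.tendsto_measure_of_null_frontier_of_tendsto' hUν
    (E := cylinder T (s + 1)) (by rw [(isClopen_cylinder T s).frontier_eq, measure_empty])
  have h2 := (ENNReal.tendsto_toReal (measure_ne_top _ _)).comp h1
  exact tendsto_nhds_unique h2 ((tendsto_real_cylinder hμ hk T s).mono_left hU)

/-- A measure is determined by its values on the cylinders of trees that reach the radius of the
cylinder, if these have full measure. -/
theorem eq_of_real_cylinder_eq {k : ℝ} {ν ν' : ProbabilityMeasure PlaneTree}
    (hν : ∀ (T : PlaneTree) (s : ℕ),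
      (ν : Measure PlaneTree).real (cylinder T (s + 1)) = limitWeight k T s)
    (hν' : ∀ (T : PlaneTree) (s : ℕ), T.trunc s = T → (T.level (s + 1)).Nonempty →
      (ν' : Measure PlaneTree).real (cylinder T (s + 1)) = limitWeight k T s) : ν' = ν := by
  have heq : ∀ (T : PlaneTree) (s : ℕ), (T.level (s + 1)).Nonempty →
      (ν' : Measure PlaneTree) (cylinder T (s + 1)) = (ν : Measure PlaneTree) (cylinder T (s + 1)) := by
    intro T s hT
    rw [← cylinder_trunc, ← measureReal_eq_measureReal_iff, hν, hν' _ _ (T.trunc_trunc s)]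
    rwa [level_eq_of_rootBall_eq (T.rootBall_trunc s)]
  have hzero : ∀ (T : PlaneTree) (s : ℕ), T.level (s + 1) = ∅ →
      (ν : Measure PlaneTree) (cylinder T (s + 1)) = 0 := by
    intro T s hT
    have h1 := hν T s
    rw [limitWeight, hT, Set.ncard_empty, Nat.cast_zero, zero_mul, mul_zero] at h1
    exact (measureReal_eq_zero_iff).1 h1
  refine probabilityMeasure_ext fun T s => ?_
  rcases (T.level (s + 1)).eq_empty_or_nonempty with hT | hT
  swap
  · exact heq T s hT
  rw [hzero T s hT]
  -- `H` consists of the trees reaching level `s + 1`. It has full measure under `ν`, and its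
  -- `ν'`-mass is the same by countable additivity, so `ν'` also ignores the shorter trees, about
  -- which the ball formula is silent at this radius.
  set H : Set PlaneTree := ⋃ S : {S : TruncatedTree s // (S.1.level (s + 1)).Nonempty},
    cylinder S.1.1 (s + 1) with hH
  have hHm : MeasurableSet H := MeasurableSet.iUnion fun S => measurableSet_cylinder _ s
  have hHeq : ∀ ρ : ProbabilityMeasure PlaneTree, (ρ : Measure PlaneTree) H =
      ∑' S : {S : TruncatedTree s // (S.1.level (s + 1)).Nonempty},
        (ρ : Measure PlaneTree) (cylinder S.1.1 (s + 1)) := by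
    intro ρ
    refine measure_iUnion (fun S S' h => ?_) fun S => measurableSet_cylinder _ s
    exact pairwise_disjoint_cylinder s fun h' => h (Subtype.ext h')
  have hsub : Hᶜ ⊆ ⋃ S : {S : TruncatedTree s // S.1.level (s + 1) = ∅},
      cylinder S.1.1 (s + 1) := by
    intro S hS
    rcases (S.level (s + 1)).eq_empty_or_nonempty with h | h
    · refine Set.mem_iUnion.2 ⟨⟨⟨S.trunc s, S.trunc_trunc s⟩, ?_⟩, S.mem_cylinder_trunc s⟩
      rw [level_eq_of_rootBall_eq (S.rootBall_trunc s), h]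
    · refine absurd (Set.mem_iUnion.2 ⟨⟨⟨S.trunc s, S.trunc_trunc s⟩, ?_⟩,
        S.mem_cylinder_trunc s⟩) hS
      rwa [level_eq_of_rootBall_eq (S.rootBall_trunc s)]
  have h0 : (ν : Measure PlaneTree) Hᶜ = 0 := by
    refine measure_mono_null hsub (measure_iUnion_null fun S => hzero _ _ S.2)
  have h1 : (ν' : Measure PlaneTree) H = 1 := by
    rw [hHeq, ← (prob_compl_eq_zero_iff hHm).1 h0, hHeq]
    exact tsum_congr fun S => heq _ _ S.2
  refine measure_mono_null ?_ ((prob_compl_eq_zero_iff hHm).2 h1)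
  intro S hS hSH
  obtain ⟨S', hS'⟩ := Set.mem_iUnion.1 hSH
  have h2 := S'.2
  rw [← level_eq_of_rootBall_eq hS', level_eq_of_rootBall_eq hS, hT] at h2
  exact Set.not_nonempty_empty h2

theorem limitWeight_eq {k g : ℝ} (hk : 1 < k) (hg : g = criticalPoint k) {T₀ : PlaneTree}
    {n s K : ℕ} (hn : T₀.size = n) (hs : T₀.height = (s + 1 : ℕ))
    (hK : (T₀.level (s + 1)).encard = K) :
    limitWeight k T₀ s = K * k ^ (s + 1 - 1) * g ^ (n - K) * genFun g ^ (K - 1) := by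
  have h1 := size_eq_coreSize_add hn hs hK
  have h2 : (T₀.level (s + 1)).ncard = K := by rw [Set.ncard, hK, ENat.toNat_natCast]
  rw [limitWeight, h2, hg, genFun_criticalPoint hk, h1, Nat.add_sub_cancel, Nat.add_sub_cancel]
  ring

/-- Finite trees of height `r = s + 1` are exactly the trees equal to their truncation whose top
level is occupied. -/
theorem real_closedBall_iff {k g : ℝ} (hk : 1 < k) (hg : g = criticalPoint k)
    (ν : ProbabilityMeasure PlaneTree) :
    (∀ (T₀ : PlaneTree) (n r K : ℕ), T₀.size = n → T₀.height = r → (T₀.level r).encard = K →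
      (ν : Measure PlaneTree).real (Metric.closedBall T₀ (1 / (r : ℝ))) =
        K * k ^ (r - 1) * g ^ (n - K) * genFun g ^ (K - 1)) ↔
    ∀ (T : PlaneTree) (s : ℕ), T.trunc s = T → (T.level (s + 1)).Nonempty →
      (ν : Measure PlaneTree).real (cylinder T (s + 1)) = limitWeight k T s := by
  constructor
  · intro h T s hT hne
    have hs : T.height = (s + 1 : ℕ) := hT ▸ height_trunc_eq hne
    have hn := (ENat.natCast_toNat (size_ne_top_of_trunc_eq hT)).symm
    have hK := T.encard_level_eq_ncard (s + 1)
    rw [limitWeight_eq hk hg hn hs hK, ← h T _ _ _ hn hs hK,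
      closedBall_eq_cylinder T (Nat.le_add_left 1 s)]
  · intro h T n r K hn hr hK
    obtain ⟨s, rfl⟩ : ∃ s, r = s + 1 := by
      refine Nat.exists_eq_succ_of_ne_zero ?_
      rintro rfl
      have := T.one_le_height
      simp [hr] at this
    have hT := (height_eq_iff T (s + 1)).1 hr
    rw [← limitWeight_eq hk hg hn hr hK, closedBall_eq_cylinder T (Nat.le_add_left 1 s)]
    refine h T s (PlaneTree.ext (Set.ext fun v => ?_)) hT.2
    exact ⟨fun hv => hv.1, fun hv => ⟨hv, hT.1 v hv⟩⟩

end PlaneTree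

/-! ### Assembly of the main theorem -/

theorem mainTheorem2 (μ : ℝ) (hμ : μ < 0) (k g : ℝ) (hk : k = Real.exp (-μ))
    (hg : g = PlaneTree.criticalPoint k) :
    -- the series defining `X(g_c(k))` converges
    Summable (fun T : {T : PlaneTree // T.size ≠ ⊤} => g ^ T.1.size.toNat) ∧
    -- each `ν_N`, `N ≥ 1`, is a probability measure
    ∃ hprob : ∀ N : ℕ, IsProbabilityMeasure (PlaneTree.finiteSizeMeasure μ (N + 1)),
    ∃ ν : ProbabilityMeasure PlaneTree,
      -- weak convergence of `(ν_N)_{N ≥ 1}` to `ν`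
      Tendsto (β := ProbabilityMeasure PlaneTree)
        (fun N : ℕ => ⟨PlaneTree.finiteSizeMeasure μ (N + 1), hprob N⟩)
        atTop (𝓝 ν) ∧
      -- `ν` satisfies the ball formula
      (∀ (T₀ : PlaneTree) (n r K : ℕ), T₀.size = n → T₀.height = r → (T₀.level r).encard = K →
        (ν : Measure PlaneTree).real (Metric.closedBall T₀ (1 / (r : ℝ))) =
          K * k ^ (r - 1) * g ^ (n - K) * PlaneTree.genFun g ^ (K - 1)) ∧
      -- and is the only probability measure that does so
      ∀ ν' : ProbabilityMeasure PlaneTree,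
        (∀ (T₀ : PlaneTree) (n r K : ℕ), T₀.size = n → T₀.height = r →
          (T₀.level r).encard = K →
          (ν' : Measure PlaneTree).real (Metric.closedBall T₀ (1 / (r : ℝ))) =
            K * k ^ (r - 1) * g ^ (n - K) * PlaneTree.genFun g ^ (K - 1)) →
        ν' = ν := by
  have hk1 := PlaneTree.one_lt_of_eq_exp hμ hk
  refine ⟨by rw [hg]; exact (PlaneTree.hasSum_pow_size hk1).summable,
    PlaneTree.isProbabilityMeasure_finiteSizeMeasure μ, ?_⟩
  have hcomp := PlaneTree.isCompact_closure_range_finiteSizeLaw hμ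
  obtain ⟨ν, -, hν⟩ := hcomp.exists_mapClusterPt (f := atTop) (u := PlaneTree.finiteSizeLaw μ)
    (by
      rw [le_principal_iff, mem_map]
      exact Eventually.of_forall fun N => subset_closure ⟨N, rfl⟩)
  have hcyl := PlaneTree.real_cylinder_of_mapClusterPt hμ hk hν
  refine ⟨ν, ?_, (PlaneTree.real_closedBall_iff hk1 hg ν).2 fun T s _ _ => hcyl T s,
    fun ν' hν' => PlaneTree.eq_of_real_cylinder_eq hcyl
      ((PlaneTree.real_closedBall_iff hk1 hg ν').1 hν')⟩
  -- A sequence in a compact set converges as soon as it has only one cluster point; all cluster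
  -- points agree on cylinders.
  refine hcomp.tendsto_nhds_of_unique_mapClusterPt
    (Eventually.of_forall fun N => subset_closure ⟨N, rfl⟩) fun ν' _ hν' => ?_
  exact PlaneTree.eq_of_real_cylinder_eq hcyl fun T s _ _ =>
    PlaneTree.real_cylinder_of_mapClusterPt hμ hk hν' T s
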